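/- **Algorithm (lean-consensus).** Processes $p_0,p_1,p_2,\dots$ share two infinite arrays $a_0,a_1$ of atomic read/write bits, all initially $0$ except $a_0[0]=a_1[0]=1$. A process with input bit $b$ sets its preference $p:=b$ and its round number $\rho:=1$, and then repeats the following round of four operations: (1) read $a_0[\rho]$; (2) read $a_1[\rho]$, and if for some bit $b$ the values read satisfy $a_b[\rho]=1$ and $a_{1-b}[\rho]=0$, set $p:=b$; (3) write $1$ to $a_p[\rho]$; (4) read $a_{1-p}[\rho-1]$; if the value is $0$, decide $p$ and exit, otherwise set $\rho:=\rho+1$ and repeat. A global state (register contents and local states of all processes) is *reachable* if it arises from an initial state, with arbitrary inputs, by finitely many operations executed in an arbitrary order. **Noisy scheduling with random halting failures.** Fix, for each operation type $\pi\in\{\text{read},\text{write}\}$, a probability distribution $F_\pi$ on the non-negative reals that is not concentrated on a point, a constant $M$, and a function $h:\mathbb N\to[0,1]$. Starting from a given global state, let $A$ be a set of $n$ active processes (none of which has decided); all other processes take no further steps. The adversary chooses real constants $\Delta_{ij}$ for $i\in A$, $j\ge 0$, where the starting times $\Delta_{i0}$ are arbitrary and $0\le\Delta_{ij}\le M$ for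 $j\ge1$. Let $X_{ij}$ and $H_{ij}$ ($i\in A$, $j\ge 1$) be mutually independent random variables, where $X_{ij}$ has distribution $F_\pi$ if the $j$-th operation of $p_i$ from the start is of type $\pi$, and $H_{ij}$ is $\infty$ with probability $h(n)$ and $0$ otherwise. The $j$-th operation of $p_i$, counted from the start, occurs at time $$S'_{ij}=\Delta_{i0}+\sum_{k=1}^{j}\left(\Delta_{ik}+X_{ik}+H_{ik}\right),$$ provided that $p_i$ has not decided before and that $S'_{ij}<\infty$; if $S'_{ij}=\infty$, the process has halted and the operation does not occur. The adversary's choices are required to be such that, with probability $1$, no two operations of distinct processes have the same finite time $S'_{ij}=S'_{i'j'}$. Operations are executed in order of their times, those of the same process in order of their index $j$. The algorithm *terminates by round $R$* if after finitely many operations every active process has decided or halted, and no operation was executed (after the start) by a process whose round number was larger than $R$. **Theorem.** For all $F_{\mathrm{read}},F_{\mathrm{write}}$, $M$ and $h$ as above there is a constant $C>0$, depending only on these data, such that the following holds for every $n\ge 2$, every reachable state, every set $A$ of $n$ active processes in it, and every choice of the $\Delta_{ij}$ as above. Let $r$ be the largest round number of any process in the starting state, and let $r'\in\{0,1,2,\dots\}\cup\{\infty\}$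 be the least number such that the algorithm, started from this state, terminates by round $r+r'$. Then $$\mathbb E[r']\le C\log n\qquad\text{and}\qquad \Pr[r'>k]\le e^{-\lfloor k/(C\log n)\rfloor}\quad\text{for every real } k\ge0 .$$ -/

import Mathlib

open MeasureTheory ProbabilityTheory
open scoped ENNReal

namespace NoisyConsensus

/-! ## The algorithm

Processes are numbered by `ℕ`; bits are `Bool`, with `false` for `0` and `true` for `1`. -/

/-- The two types of operations on the shared registers. -/
inductive OpType where
  | read
  | write

/-- Which operation a process executes next within its current round (or that it has exited).
`readOne v` carries the value `v` that the process has just read from `a₀[r]`. -/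
inductive Loc where
  | readZero
  | readOne (v : Bool)
  | writePref
  | readRival
  | decided

/-- Position in the fixed sequence of four operations of a round. -/
def Loc.stage : Loc → ℕ
  | .readZero => 0
  | .readOne _ => 1
  | .writePref => 2
  | .readRival => 3
  | .decided => 0

/-- The type of the `j`-th operation (`j ≥ 1`) that a process now at location `l` will execute,
counted from now: each round consists of two reads, a write and another read. -/
def opType (l : Loc) (j : ℕ) : OpType :=
  if (l.stage + j) % 4 = 3 then .write else .read

/-- The local state of a process. In location `decided`, `pref` is the decision value. -/
structure ProcState where
  pref : Bool
  round : ℕ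
  loc : Loc

/-- A global state: `mem b r` is the content of register `a_b[r]`. -/
structure Config where
  mem : Bool → ℕ → Bool
  proc : ℕ → ProcState

/-- The initial state for given input bits: all registers are `0`, except for the read-only prefix
`a₀[0] = a₁[0] = 1`. -/
def Config.init (input : ℕ → Bool) : Config where
  mem := fun _ r => decide (r = 0)
  proc := fun i => ⟨input i, 1, .readZero⟩

/-- The new preference after reading `v₀` from `a₀[r]` and `v₁` from `a₁[r]`. -/
def newPref (v₀ v₁ pref : Bool) : Bool :=
  match v₀, v₁ with
  | true, false => false
  | false, true => true
  | _, _ => pref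

/-- Replace the local state of process `i`. -/
def Config.setProc (c : Config) (i : ℕ) (p : ProcState) : Config :=
  ⟨c.mem, Function.update c.proc i p⟩

/-- Set register `a_b[r]` to `1`. -/
def Config.mark (c : Config) (b : Bool) (r : ℕ) : Config :=
  ⟨Function.update c.mem b (Function.update (c.mem b) r true), c.proc⟩

/-- Process `i` executes its next operation, with the local computation that follows it.
A process that has decided does nothing. -/
def Config.step (c : Config) (i : ℕ) : Config :=
  let p := c.proc i
  match p.loc with
  | .readZero => c.setProc i ⟨p.pref, p.round, .readOne (c.mem false p.round)⟩
  | .readOne v => c.setProc i ⟨newPref v (c.mem true p.round) p.pref, p.round, .writePref⟩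
  | .writePref => (c.mark p.pref p.round).setProc i ⟨p.pref, p.round, .readRival⟩
  | .readRival =>
      if c.mem (!p.pref) (p.round - 1) = false then c.setProc i ⟨p.pref, p.round, .decided⟩
      else c.setProc i ⟨p.pref, p.round + 1, .readZero⟩
  | .decided => c

/-- The states that can arise from some initial state by finitely many operations, executed in
any order. -/
inductive Reachable : Config → Prop
  | init (input : ℕ → Bool) : Reachable (Config.init input)
  | step {c : Config} (i : ℕ) : Reachable c → Reachable (c.step i)

/-! ## Execution of a timetable

`T i j` is the time of the `j`-th operation (`j ≥ 1`) of process `i`, counted from the start;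
it is `⊤` if process `i` halts before that operation. Only the processes in the finite set `A`
take steps. -/

/-- A state of a running execution, with the number of operations each process has executed. -/
structure RunState where
  cfg : Config
  count : ℕ → ℕ

open Classical in
/-- The processes in `A` that will execute a further operation: they have neither decided nor
halted. -/
noncomputable def pending (A : Finset ℕ) (T : ℕ → ℕ → EReal) (s : RunState) : Finset ℕ :=
  A.filter fun i => (s.cfg.proc i).loc ≠ .decided ∧ T i (s.count i + 1) ≠ ⊤

open Classical in
/-- The pending processes whose next operation comes first. -/
noncomputable def earliest (A : Finset ℕ) (T : ℕ → ℕ → EReal) (s : RunState) : Finset ℕ :=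
  (pending A T s).filter fun i => ∀ k ∈ pending A T s, T i (s.count i + 1) ≤ T k (s.count k + 1)

open Classical in
/-- The process that executes the next operation, if there is one. (Two processes are never
scheduled for the same time, except with probability zero; such ties go to the smaller index.) -/
noncomputable def mover (A : Finset ℕ) (T : ℕ → ℕ → EReal) (s : RunState) : Option ℕ :=
  if hs : (earliest A T s).Nonempty then some ((earliest A T s).min' hs) else none

/-- One step of the execution. -/
noncomputable def RunState.next (A : Finset ℕ) (T : ℕ → ℕ → EReal) (s : RunState) : RunState :=
  match mover A T s with
  | some i => ⟨s.cfg.step i, Function.update s.count i (s.count i + 1)⟩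
  | none => s

/-- The state after `m` operations, starting from the state `c`. -/
noncomputable def run (A : Finset ℕ) (T : ℕ → ℕ → EReal) (c : Config) : ℕ → RunState
  | 0 => ⟨c, fun _ => 0⟩
  | m + 1 => (run A T c m).next A T

/-- The execution from `c` terminates by round `R`: after finitely many operations every process
in `A` has decided or halted, and no operation was executed in a round later than `R`. -/
def TerminatesBy (A : Finset ℕ) (T : ℕ → ℕ → EReal) (c : Config) (R : ℕ) : Prop :=
  ∃ m : ℕ, pending A T (run A T c m) = ∅ ∧
    ∀ m' < m, ∀ i, mover A T (run A T c m') = some i → ((run A T c m').cfg.proc i).round ≤ R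

/-- The least `r'` such that the execution from `c` terminates by round `r + r'`
(`⊤` if there is none). -/
noncomputable def extraRounds (A : Finset ℕ) (T : ℕ → ℕ → EReal) (c : Config) (r : ℕ) : ℕ∞ :=
  sInf {x : ℕ∞ | ∃ k : ℕ, x = k ∧ TerminatesBy A T c (r + k)}

/-! ## Noisy scheduling with random halting failures -/

/-- The time `S'_{ij} = Δ_{i0} + ∑_{k=1}^{j} (Δ_{ik} + X_{ik} + H_{ik})` of process `i`'s `j`-th
operation, on the sample point `ω`. -/
noncomputable def opTime {Ω : Type*} (Δ : ℕ → ℕ → ℝ) (X : ℕ → ℕ → Ω → ℝ) (H : ℕ → ℕ → Ω → EReal)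
    (ω : Ω) (i j : ℕ) : EReal :=
  (Δ i 0 : EReal) + ∑ k ∈ Finset.Icc 1 j, ((Δ i k : EReal) + (X i k ω : EReal) + H i k ω)

/-- Adversarial delays `Δ`, noise `X` and failures `H` form a noisy schedule for the processes in
`A` starting from the state `c`, with noise distributions `F`, delay bound `M` and failure
probability `p` per operation. -/
structure IsNoisySchedule {Ω : Type*} [MeasurableSpace Ω] (μ : Measure Ω)
    (F : OpType → Measure ℝ) (M p : ℝ) (c : Config) (A : Finset ℕ)
    (Δ : ℕ → ℕ → ℝ) (X : ℕ → ℕ → Ω → ℝ) (H : ℕ → ℕ → Ω → EReal) : Prop where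
  /-- Delays are non-negative and at most `M`; the starting times `Δ i 0` are arbitrary. -/
  delay_mem : ∀ i ∈ A, ∀ j, 1 ≤ j → Δ i j ∈ Set.Icc 0 M
  measurable_noise : ∀ i ∈ A, ∀ j, 1 ≤ j → Measurable (X i j)
  /-- The noise of an operation of type `π` has law `F π`. -/
  law_noise : ∀ i ∈ A, ∀ j, 1 ≤ j → μ.map (X i j) = F (opType (c.proc i).loc j)
  measurable_halt : ∀ i ∈ A, ∀ j, 1 ≤ j → Measurable (H i j)
  halt_eq : ∀ i ∈ A, ∀ j, 1 ≤ j → ∀ ω, H i j ω = 0 ∨ H i j ω = ⊤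
  /-- Each process halts before each of its operations with probability `p`. -/
  prob_halt : ∀ i ∈ A, ∀ j, 1 ≤ j → μ {ω | H i j ω = ⊤} = ENNReal.ofReal p
  /-- All the variables `X i j` and `H i j`, for `i ∈ A` and `j ≥ 1`, are independent. -/
  indep : iIndepFun
    (Sum.elim (fun (q : A × ℕ) (ω : Ω) => (X q.1 (q.2 + 1) ω : EReal))
      (fun (q : A × ℕ) (ω : Ω) => H q.1 (q.2 + 1) ω)) μ
  /-- Almost surely, no two operations of distinct processes occur at the same time. -/
  no_ties : ∀ i ∈ A, ∀ i' ∈ A, i ≠ i' → ∀ j j', 1 ≤ j → 1 ≤ j' →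
    μ {ω | opTime Δ X H ω i j = opTime Δ X H ω i' j' ∧ opTime Δ X H ω i j ≠ ⊤} = 0

end NoisyConsensus

namespace NoisyConsensus

/-! ## The execution as a deterministic process -/

/-! The proof separates a deterministic fact about the algorithm from a probabilistic fact about
races of random sums.

Deterministic part. If one process performs its write in round `R` before any other process starts
that round, its bit `b` is the only one visible there. Every later arrival adopts `b`, nobody writes
the opposite bit in round `R` or later, and all rounds stay at most `R + 1`. The condition
`Config.Locked` is an inductive invariant expressing this (`Config.Locked.step`). It also holds as
soon as some process is about to decide (`Config.WellFormed.locked`), so early decisions do no harm.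
Bounded rounds force termination, whence `Leads.terminatesBy`: a lead in round `R`, or nobody
reaching it, ends the execution by round `R + 1`.

Probabilistic part. Let `f t` be the expected number of processes that execute the first read of a
given round by time `t`. If `f` stays below `1/2`, then with probability at least `1/2` everyone
halts first. Otherwise choose `t` with `f t ≥ 1/2 > f (t - d)`. Because the noise is not constant,
exchanging a large summand for a small one shows that the lower tail of a sum of many noise terms
loses only a constant factor under a bounded shift, up to an error exponentially small in the number
of terms (`lower_tail_shift_iterate`). Hence the expected number of processes that even complete the
write of that round by `t - d` is bounded below by a constant, while the expected number that start
the round by then is below `1/2`. Independence of the processes makes exactly one of them early with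
constant probability (`half_sum_le_measure_unique`), and that one leads.

The exponential error must be summed over `n` processes, so the argument needs about `log n` rounds
of accumulated noise. In a block of that length a lead occurs with probability at least a constant
`ε`, whatever the times at the start of the block (`IsNoisySchedule.blockLead`). Successive blocks
use fresh variables, so `k` blocks all fail with probability at most `(1 - ε) ^ k`
(`IsNoisySchedule.measure_no_lead_le`). Both claimed bounds follow from this geometric decay. -/

theorem step_mem (c : Config) (i : ℕ) (b : Bool) (ρ : ℕ) :
    (c.step i).mem b ρ = true ↔ c.mem b ρ = true ∨
      ((c.proc i).loc = .writePref ∧ (c.proc i).pref = b ∧ (c.proc i).round = ρ) := by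
  unfold Config.step
  rcases hl : (c.proc i).loc with _ | v | _ | _ | _ <;> simp only [hl, Config.setProc, Config.mark]
  case readRival => split_ifs <;> simp
  case writePref =>
    by_cases hb : b = (c.proc i).pref
    · subst hb
      by_cases hr : ρ = (c.proc i).round
      · simp [hr]
      · simp [hr, Ne.symm hr]
    · simp [hb, Ne.symm hb]
  all_goals simp

theorem step_proc_of_ne (c : Config) {i j : ℕ} (h : j ≠ i) : (c.step i).proc j = c.proc j := by
  unfold Config.step
  rcases hl : (c.proc i).loc with _ | v | _ | _ | _ <;> simp only [hl, Config.setProc, Config.mark]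
  case readRival => split_ifs <;> simp [h]
  all_goals simp [h]

/-- What a process does to its own local state. -/
def localStep (mem : Bool → ℕ → Bool) (p : ProcState) : ProcState :=
  match p.loc with
  | .readZero => ⟨p.pref, p.round, .readOne (mem false p.round)⟩
  | .readOne v => ⟨newPref v (mem true p.round) p.pref, p.round, .writePref⟩
  | .writePref => ⟨p.pref, p.round, .readRival⟩
  | .readRival =>
      if mem (!p.pref) (p.round - 1) = false then ⟨p.pref, p.round, .decided⟩
      else ⟨p.pref, p.round + 1, .readZero⟩
  | .decided => p

theorem step_proc_self (c : Config) (i : ℕ) :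
    (c.step i).proc i = localStep c.mem (c.proc i) := by
  unfold Config.step localStep
  rcases hl : (c.proc i).loc with _ | v | _ | _ | _ <;> simp only [hl, Config.setProc, Config.mark]
  case readRival => split_ifs <;> simp
  all_goals simp

theorem step_proc (c : Config) (i j : ℕ) :
    (c.step i).proc j = if j = i then localStep c.mem (c.proc i) else c.proc j := by
  split_ifs with h
  · rw [h, step_proc_self]
  · exact step_proc_of_ne c h

/-- Properties of the registers and local states that hold in every reachable state. -/
structure Config.WellFormed (c : Config) : Prop where
  mem_prev : ∀ b ρ, c.mem b (ρ + 1) = true → c.mem b ρ = true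
  pref_prev : ∀ i, c.mem (c.proc i).pref ((c.proc i).round - 1) = true
  readOne_mem : ∀ i, (c.proc i).loc = .readOne true → c.mem false (c.proc i).round = true
  readRival_mem : ∀ i, (c.proc i).loc = .readRival →
    c.mem (c.proc i).pref (c.proc i).round = true
  round_pos : ∀ i, 1 ≤ (c.proc i).round
  mem_passed : ∀ i b ρ, ρ + 2 ≤ (c.proc i).round → c.mem b ρ = true
  mem_bound : ∀ b ρ, c.mem b ρ = true → ρ = 0 ∨ ∃ i, ρ ≤ (c.proc i).round

theorem Config.WellFormed.init (input : ℕ → Bool) : (Config.init input).WellFormed := by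
  constructor <;> simp +contextual [Config.init]

theorem round_le_localStep (mem : Bool → ℕ → Bool) (p : ProcState) :
    p.round ≤ (localStep mem p).round := by
  unfold localStep
  split <;> try split_ifs
  all_goals simp

theorem round_le_step (c : Config) (i j : ℕ) : (c.proc j).round ≤ ((c.step i).proc j).round := by
  rw [step_proc]
  split_ifs with h
  · rw [h]; exact round_le_localStep _ _
  · exact le_rfl

/-- Registers only ever change from `0` to `1`, so every positive claim about memory persists; only
what the moving process newly asserts needs an argument. -/
theorem Config.WellFormed.step {c : Config} (hc : c.WellFormed) (i : ℕ) :
    (c.step i).WellFormed := by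
  have hmono : ∀ b ρ, c.mem b ρ = true → (c.step i).mem b ρ = true := fun b ρ h =>
    (step_mem c i b ρ).2 (Or.inl h)
  constructor
  · intro b ρ h
    rcases (step_mem c i b (ρ + 1)).1 h with h | ⟨-, h2, h3⟩
    · exact hmono _ _ (hc.mem_prev _ _ h)
    · have := hc.pref_prev i
      rw [h2, h3] at this
      exact hmono _ _ this
  · intro j
    rw [step_proc]
    split_ifs with h
    · have hp := hc.pref_prev i
      have h1 := hc.round_pos i
      obtain ⟨ρ, hρ⟩ : ∃ ρ, (c.proc i).round = ρ + 1 := ⟨_, (Nat.sub_add_cancel h1).symm⟩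
      unfold localStep
      split
      · exact hmono _ _ hp
      · rename_i v hl
        -- If the preference changes, the adopted bit is already marked in the current round, and
        -- marks have no gaps below.
        apply hmono
        simp only [hρ, Nat.add_sub_cancel] at hp ⊢
        have h3 := hc.readOne_mem i
        have h4 := hc.mem_prev true ρ
        have h5 := hc.mem_prev false ρ
        rw [hρ] at h3
        rw [hl] at h3
        rcases v with _ | _ <;> rcases hm : c.mem true (ρ + 1) with _ | _ <;>
          simp_all [newPref]
      · exact hmono _ _ hp
      · rename_i hl
        split_ifs
        · exact hmono _ _ hp
        · simpa using hmono _ _ (hc.readRival_mem i hl)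
      · exact hmono _ _ hp
    · exact hmono _ _ (hc.pref_prev j)
  · intro j
    rw [step_proc]
    split_ifs with h
    · unfold localStep
      split
      · intro h'
        simp only [Loc.readOne.injEq] at h'
        exact hmono _ _ h'
      · simp
      · simp
      · split_ifs <;> simp
      · simp_all
    · exact fun h => hmono _ _ (hc.readOne_mem j h)
  · intro j
    rw [step_proc]
    split_ifs with h
    · unfold localStep
      split
      · simp
      · simp
      · rename_i hl
        intro _
        exact (step_mem _ _ _ _).2 (Or.inr ⟨hl, rfl, rfl⟩)
      · split_ifs <;> simp
      · simp_all
    · exact fun h => hmono _ _ (hc.readRival_mem j h)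
  · intro j
    exact (hc.round_pos j).trans (round_le_step c i j)
  · intro j b ρ
    rw [step_proc]
    split_ifs with h
    · unfold localStep
      split
      · exact fun h => hmono _ _ (hc.mem_passed i b ρ h)
      · exact fun h => hmono _ _ (hc.mem_passed i b ρ h)
      · exact fun h => hmono _ _ (hc.mem_passed i b ρ h)
      · split_ifs with hm
        · exact fun h => hmono _ _ (hc.mem_passed i b ρ h)
        · intro h'
          simp only at h'
          rcases Nat.lt_or_ge (ρ + 1) (c.proc i).round with hlt | hge
          · exact hmono _ _ (hc.mem_passed i b ρ hlt)
          -- The one new pair of registers: the process's own bit is marked by `pref_prev`, and the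
          -- rival bit is what it has just read as `1`.
          · have hρ : ρ = (c.proc i).round - 1 := by omega
            have hp := hc.pref_prev i
            apply hmono
            rw [hρ]
            rcases b.eq_or_eq_not (c.proc i).pref with hb | hb
            · rw [hb]; exact hp
            · rw [hb]; simpa using hm
      · exact fun h => hmono _ _ (hc.mem_passed i b ρ h)
    · exact fun h => hmono _ _ (hc.mem_passed j b ρ h)
  · intro b ρ h
    rcases (step_mem c i b ρ).1 h with h | ⟨-, -, h3⟩
    · rcases hc.mem_bound b ρ h with h | ⟨j, hj⟩
      · exact Or.inl h
      · exact Or.inr ⟨j, hj.trans (round_le_step c i j)⟩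
    · exact Or.inr ⟨i, h3 ▸ round_le_step c i i⟩

theorem Reachable.wellFormed {c : Config} (hc : Reachable c) : c.WellFormed := by
  induction hc with
  | init input => exact .init input
  | step i _ ih => exact ih.step i

/-! ### Locked states and how they arise -/

/-- From such a state on, every process that passes round `R` prefers `b`, and every process decides
by round `R + 1`. -/
structure Config.Locked (c : Config) (b : Bool) (R : ℕ) : Prop where
  mem_win : c.mem b R = true
  mem_lose : c.mem (!b) R = false
  mem_lose_succ : c.mem (!b) (R + 1) = false
  round_le : ∀ i, (c.proc i).round ≤ R + 1
  readOne : ∀ i v, (c.proc i).round = R → (c.proc i).loc = .readOne v →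
    (b = true → v = false) ∧ (b = false → v = true ∨ (c.proc i).pref = false)
  later : ∀ i, (c.proc i).round = R → (c.proc i).loc = .writePref ∨ (c.proc i).loc = .readRival →
    (c.proc i).pref = b
  succ : ∀ i, (c.proc i).round = R + 1 → (c.proc i).pref = b ∧
    ((c.proc i).loc = .readOne true → b = false)

/-- Whoever writes in round `R` or later prefers `b`, so the losing registers stay blank. A process
in round `R + 1` therefore keeps `b` and reads `0` from the rival register of round `R`, hence
decides. The asymmetry of `readOne` reflects that a read of `a₀[R]` may predate the winning write.
-/
theorem Config.Locked.step {c : Config} {b : Bool} {R : ℕ} (hc : c.Locked b R) (i : ℕ) :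
    (c.step i).Locked b R := by
  obtain ⟨h1, h2, h3, h4, h5, h6, h7⟩ := hc
  have hpref : (c.proc i).loc = .writePref → R ≤ (c.proc i).round → (c.proc i).pref = b := by
    intro hl hr
    rcases hr.eq_or_lt with h | h
    · exact h6 i h.symm (Or.inl hl)
    · exact (h7 i (le_antisymm (h4 i) h)).1
  have hlose : ∀ ρ, R ≤ ρ → c.mem (!b) ρ = false → (c.step i).mem (!b) ρ = false := by
    intro ρ hρ h
    rw [← Bool.not_eq_true, step_mem]
    rintro (h' | ⟨ha, hb, hd⟩)
    · simp [h] at h'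
    · rw [hpref ha (hd ▸ hρ)] at hb
      simp at hb
  refine ⟨(step_mem _ _ _ _).2 (Or.inl h1), hlose R le_rfl h2, hlose _ (Nat.le_succ R) h3, ?_, ?_, ?_,
    ?_⟩
  all_goals
    intro j
    rw [step_proc]
    by_cases hj : j = i
    swap
    · simp only [hj, if_false]
      first
      | exact h4 j
      | exact h5 j
      | exact h6 j
      | exact h7 j
    rw [if_pos hj]
    have g4 := h4 i
    have g5 := h5 i
    have g6 := h6 i
    have g7 := h7 i
    unfold localStep
    rcases hl : (c.proc i).loc with _ | v | _ | _ | _ <;> simp only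
  all_goals rw [hl] at g5 g6 g7
  all_goals first
    | grind
    | (rcases b with _ | _ <;> simp_all <;> grind [newPref])

/-- The number of operations that a process executes before its first operation in round `R`. -/
def opsBefore (p : ProcState) (R : ℕ) : ℕ := 4 * (R - p.round) - p.loc.stage

/-- The position of a local state in the sequence of all operations of a process. -/
def ProcState.pos (p : ProcState) : ℕ := 4 * p.round + p.loc.stage

theorem Loc.stage_lt (l : Loc) : l.stage < 4 := by
  cases l <;> simp [Loc.stage]

/-- Positions advance by one per operation only while the process is undecided: `decided` has stage
`0` and falls outside the count. -/
theorem localStep_pos (mem : Bool → ℕ → Bool) (p : ProcState)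
    (h : (localStep mem p).loc ≠ .decided) :
    p.loc ≠ .decided ∧ (localStep mem p).pos = p.pos + 1 := by
  revert h
  unfold localStep
  rcases hl : p.loc with _ | v | _ | _ | _ <;> simp only
  case readRival =>
    split_ifs <;> simp [ProcState.pos, Loc.stage, hl]
    omega
  all_goals simp [ProcState.pos, Loc.stage, hl]

theorem localStep_decided (mem : Bool → ℕ → Bool) (p : ProcState)
    (hp : p.loc ≠ .decided) (h : (localStep mem p).loc = .decided) :
    p.loc = .readRival ∧ mem (!p.pref) (p.round - 1) = false := by
  revert h
  unfold localStep
  rcases hl : p.loc with _ | v | _ | _ | _ <;> simp only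
  case readRival => split_ifs with hm <;> simp [hm]
  all_goals simp_all

/-- The rival bit is unmarked in round `R - 1`, hence in all later rounds. By `pref_prev` nobody in
round `R` or beyond can prefer it, and by `mem_passed` nobody can be beyond round `R + 1`. -/
theorem Config.WellFormed.locked {c : Config} (hc : c.WellFormed) {i : ℕ}
    (hl : (c.proc i).loc = .readRival)
    (hm : c.mem (!(c.proc i).pref) ((c.proc i).round - 1) = false) :
    c.Locked (c.proc i).pref (c.proc i).round := by
  set b := (c.proc i).pref
  set R := (c.proc i).round
  have hR : R - 1 + 1 = R := Nat.sub_add_cancel (hc.round_pos i)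
  have h0 : c.mem (!b) R = false := by
    rw [← Bool.not_eq_true] at hm ⊢
    exact fun h => hm (hc.mem_prev _ _ (by rwa [hR]))
  have h1 : c.mem (!b) (R + 1) = false := by
    rw [← Bool.not_eq_true] at h0 ⊢
    exact fun h => h0 (hc.mem_prev _ _ h)
  have hpref : ∀ j, R ≤ (c.proc j).round → (c.proc j).pref = b := by
    intro j hj
    by_contra hne
    have hp := hc.pref_prev j
    rw [Bool.eq_not_of_ne hne] at hp
    rcases hj.eq_or_lt with h | h
    · rw [← h, hm] at hp; cases hp
    · have : ∀ d, c.mem (!b) (R + d) = false := by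
        intro d
        induction d with
        | zero => exact h0
        | succ d ih =>
          rw [← Bool.not_eq_true] at ih ⊢
          exact fun h => ih (hc.mem_prev _ _ h)
      obtain ⟨d, hd⟩ := Nat.exists_eq_add_of_lt h
      rw [hd, Nat.add_sub_cancel, this d] at hp
      cases hp
  refine ⟨hc.readRival_mem i hl, h0, h1, ?_, ?_, ?_, ?_⟩
  · intro j
    by_contra! h
    have := hc.mem_passed j (!b) R h
    rw [h0] at this
    cases this
  · intro j v hj hv
    refine ⟨fun hb => ?_, fun hb => Or.inr (hb ▸ hpref j hj.ge)⟩
    by_contra hne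
    rw [Bool.not_eq_false] at hne
    subst hne
    have := hc.readOne_mem j hv
    rw [hj] at this
    rw [hb] at h0
    simp [this] at h0
  · exact fun j hj _ => hpref j hj.ge
  · intro j hj
    refine ⟨hpref j (by omega), fun hv => ?_⟩
    by_contra hb
    rw [Bool.not_eq_false] at hb
    have := hc.readOne_mem j hv
    rw [hj] at this
    rw [hb] at h1
    simp [this] at h1

/-- The process has not yet started round `R`. -/
def ProcState.Before (p : ProcState) (R : ℕ) : Prop :=
  p.round < R ∨ p.round = R ∧ p.loc = .readZero

theorem ProcState.Before.localStep {p : ProcState} {R : ℕ} (h : p.round < R)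
    (mem : Bool → ℕ → Bool) : (localStep mem p).Before R := by
  unfold NoisyConsensus.localStep ProcState.Before
  rcases hl : p.loc with _ | v | _ | _ | _ <;> simp only
  case readRival => split_ifs <;> simp <;> omega
  all_goals omega

/-- All registers from round `R` on are blank before this write, and no other process holds a value
read in round `R`, so the conditions on the others are vacuous. -/
theorem locked_of_lead {c : Config} {R i : ℕ} (hR : (c.proc i).round = R)
    (hl : (c.proc i).loc = .writePref) (hother : ∀ k ≠ i, (c.proc k).Before R)
    (hmem : ∀ b ρ, R ≤ ρ → c.mem b ρ = false) : (c.step i).Locked (c.proc i).pref R := by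
  have hself : (c.step i).proc i = ⟨(c.proc i).pref, R, .readRival⟩ := by
    rw [step_proc_self]; simp [localStep, hl, hR]
  have hk : ∀ k ≠ i, ((c.step i).proc k).Before R := by
    intro k hk
    rw [step_proc_of_ne c hk]
    exact hother k hk
  refine ⟨(step_mem _ _ _ _).2 (Or.inr ⟨hl, rfl, hR⟩), ?_, ?_, ?_, ?_, ?_, ?_⟩
  · rw [← Bool.not_eq_true, step_mem]
    simp [hmem]
  · rw [← Bool.not_eq_true, step_mem]
    simp [hmem]
  all_goals
    intro j
    by_cases hj : j = i
    · subst hj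
      rw [hself]
      simp
    · rcases hk j hj with h | ⟨h, h'⟩
      · intros
        omega
      · simp [h, h']

/-! ### Executions of a timetable: bounded rounds and leads -/

theorem mem_pending {A : Finset ℕ} {T : ℕ → ℕ → EReal} {s : RunState} {i : ℕ} :
    i ∈ pending A T s ↔ i ∈ A ∧ (s.cfg.proc i).loc ≠ .decided ∧ T i (s.count i + 1) ≠ ⊤ := by
  simp [pending]

theorem mover_spec {A : Finset ℕ} {T : ℕ → ℕ → EReal} {s : RunState} {i : ℕ}
    (h : mover A T s = some i) : i ∈ pending A T s ∧
      ∀ k ∈ pending A T s, T i (s.count i + 1) ≤ T k (s.count k + 1) := by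
  unfold mover at h
  split_ifs at h with hs
  have := Finset.min'_mem _ hs
  rw [Option.some.inj h] at this
  simpa [earliest] using this

theorem pending_eq_empty_of_mover {A : Finset ℕ} {T : ℕ → ℕ → EReal} {s : RunState}
    (h : mover A T s = none) : pending A T s = ∅ := by
  unfold mover at h
  split_ifs at h with hs
  by_contra hne
  apply hs
  obtain ⟨i, hi, hmin⟩ := Finset.exists_min_image (pending A T s) (fun i => T i (s.count i + 1))
    (Finset.nonempty_iff_ne_empty.2 hne)
  exact ⟨i, by simpa [earliest] using ⟨hi, hmin⟩⟩

theorem run_cases (A : Finset ℕ) (T : ℕ → ℕ → EReal) (c : Config) (m : ℕ) :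
    (mover A T (run A T c m) = none ∧ run A T c (m + 1) = run A T c m) ∨
    ∃ i, mover A T (run A T c m) = some i ∧
      run A T c (m + 1) = ⟨(run A T c m).cfg.step i,
        Function.update (run A T c m).count i ((run A T c m).count i + 1)⟩ := by
  rcases h : mover A T (run A T c m) with _ | i
  · exact Or.inl ⟨rfl, by simp [run, RunState.next, h]⟩
  · exact Or.inr ⟨i, rfl, by simp [run, RunState.next, h]⟩

theorem run_pos (A : Finset ℕ) (T : ℕ → ℕ → EReal) (c : Config) (m i : ℕ)
    (h : ((run A T c m).cfg.proc i).loc ≠ .decided) :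
    ((run A T c m).cfg.proc i).pos = (c.proc i).pos + (run A T c m).count i := by
  induction m with
  | zero => simp [run]
  | succ m ih =>
    rcases run_cases A T c m with ⟨-, h'⟩ | ⟨k, -, h'⟩
    · rw [h'] at h ⊢
      exact ih h
    · rw [h'] at h ⊢
      simp only [step_proc] at h ⊢
      split_ifs at h ⊢ with hk
      · subst hk
        obtain ⟨h1, h2⟩ := localStep_pos _ _ h
        rw [h2, ih h1]
        simp [add_assoc]
      · rw [ih h]
        simp [hk]

theorem run_wellFormed {A : Finset ℕ} {T : ℕ → ℕ → EReal} {c : Config} (hc : c.WellFormed)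
    (m : ℕ) : (run A T c m).cfg.WellFormed := by
  induction m with
  | zero => exact hc
  | succ m ih =>
    rcases run_cases A T c m with ⟨-, h'⟩ | ⟨k, -, h'⟩
    · rwa [h']
    · rw [h']
      exact ih.step k

/-- If the rounds stay bounded, the execution terminates. -/
theorem terminatesBy_of_round_le {A : Finset ℕ} {T : ℕ → ℕ → EReal} {c : Config} {R : ℕ}
    (h : ∀ m i, ((run A T c m).cfg.proc i).round ≤ R) : TerminatesBy A T c R := by
  suffices ∃ m, mover A T (run A T c m) = none by
    obtain ⟨m, hm⟩ := this
    exact ⟨m, pending_eq_empty_of_mover hm, fun m' _ i _ => h m' i⟩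
  -- A never-ending execution makes the total operation count grow without bound, while each process
  -- has only boundedly many positions up to round `R`.
  by_contra! hmov
  have hcount : ∀ m i, (run A T c m).count i ≤ 4 * R + 4 := by
    intro m i
    induction m with
    | zero => simp [run]
    | succ m ih =>
      rcases run_cases A T c m with ⟨-, h'⟩ | ⟨k, hk, h'⟩
      · rwa [h']
      · rw [h']
        by_cases hi : i = k
        · subst hi
          have h1 := (mem_pending.1 (mover_spec hk).1).2.1
          have h2 := run_pos A T c m i h1
          have h3 := Loc.stage_lt ((run A T c m).cfg.proc i).loc
          have h4 := h m i
          simp only [Function.update_self]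
          unfold ProcState.pos at h2
          omega
        · simpa [hi] using ih
  have hsum : ∀ m, ∑ i ∈ A, (run A T c m).count i = m := by
    intro m
    induction m with
    | zero => simp [run]
    | succ m ih =>
      rcases run_cases A T c m with ⟨h', -⟩ | ⟨k, hk, h'⟩
      · exact absurd h' (hmov m)
      · rw [h']
        have hkA : k ∈ A := (mem_pending.1 (mover_spec hk).1).1
        have h2 := Finset.sum_sdiff (f := (run A T c m).count) (Finset.singleton_subset_iff.2 hkA)
        rw [Finset.sum_singleton] at h2
        rw [Finset.sum_update_of_mem hkA]
        omega
  have := hsum (A.card * (4 * R + 4) + 1)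
  have h2 := Finset.sum_le_card_nsmul A _ _ (fun i _ => hcount (A.card * (4 * R + 4) + 1) i)
  simp only [smul_eq_mul] at h2
  omega

/-- Some process finishes its write in round `R` before any other process starts round `R`, or no
process ever starts round `R`. -/
def Leads (A : Finset ℕ) (T : ℕ → ℕ → EReal) (c : Config) (R : ℕ) : Prop :=
  (∃ i ∈ A, ∀ k ∈ A, k ≠ i →
    T i (opsBefore (c.proc i) R + 3) < T k (opsBefore (c.proc k) R + 1)) ∨
  ∀ i ∈ A, T i (opsBefore (c.proc i) R + 1) = ⊤

theorem pos_add_opsBefore {p : ProcState} {R : ℕ} (h : p.round < R) :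
    p.pos + opsBefore p R = 4 * R := by
  have := p.loc.stage_lt
  unfold ProcState.pos opsBefore
  omega

theorem round_le_of_no_start {A : Finset ℕ} {T : ℕ → ℕ → EReal} {c : Config}
    {R : ℕ} (hR : ∀ i, (c.proc i).round < R)
    (hdead : ∀ i ∈ A, T i (opsBefore (c.proc i) R + 1) = ⊤) (m i : ℕ) :
    ((run A T c m).cfg.proc i).Before R := by
  induction m generalizing i with
  | zero => exact Or.inl (hR i)
  | succ m ih =>
    rcases run_cases A T c m with ⟨-, h'⟩ | ⟨k, hk, h'⟩
    · rw [h']; exact ih i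
    · rw [h']
      simp only [step_proc]
      split_ifs with hik
      · obtain ⟨h1, h2, h3⟩ := mem_pending.1 (mover_spec hk).1
        rcases ih k with h | ⟨h, h4⟩
        · exact ProcState.Before.localStep h _
        · exfalso
          apply h3
          rw [← hdead k h1]
          have h5 := run_pos A T c m k h2
          have h6 := pos_add_opsBefore (hR k)
          rw [show ((run A T c m).cfg.proc k).pos = 4 * R by simp [ProcState.pos, h, h4, Loc.stage]]
            at h5
          congr 2
          omega
      · exact ih i

/-- Until the state locks, the leader `i` has at most reached its write in round `R` (position `4 *
R + 2`), the others have not started round `R`, and memory is blank from there on. Executing that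
write, or any decision of `i` before it, locks the state. -/
theorem locked_or_ahead {A : Finset ℕ} {T : ℕ → ℕ → EReal} {c : Config} (hc : c.WellFormed)
    {R : ℕ} (hR : ∀ i, (c.proc i).round < R) {i : ℕ} (hiA : i ∈ A)
    (hid : (c.proc i).loc ≠ .decided)
    (hmono : Monotone (T i))
    (hlead : ∀ k ∈ A, k ≠ i →
      T i (opsBefore (c.proc i) R + 3) < T k (opsBefore (c.proc k) R + 1)) (m : ℕ) :
    (∃ b, ∃ R' ≤ R, (run A T c m).cfg.Locked b R') ∨
    ((∀ b ρ, R ≤ ρ → (run A T c m).cfg.mem b ρ = false) ∧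
      (∀ k ≠ i, ((run A T c m).cfg.proc k).Before R) ∧
      ((run A T c m).cfg.proc i).loc ≠ .decided ∧
      ((run A T c m).cfg.proc i).pos ≤ 4 * R + 2) := by
  induction m with
  | zero =>
    refine Or.inr ⟨fun b ρ hρ => ?_, fun k _ => Or.inl (hR k), hid, ?_⟩
    · by_contra h
      rw [Bool.not_eq_false] at h
      rcases hc.mem_bound b ρ h with h | ⟨j, hj⟩
      · have := hR i; omega
      · have := hR j; omega
    · have := hR i
      have := (c.proc i).loc.stage_lt
      simp only [run, ProcState.pos]
      omega
  | succ m ih =>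
    rcases run_cases A T c m with ⟨-, h'⟩ | ⟨k, hk, h'⟩
    · rwa [h']
    rw [h']
    obtain ⟨hkA, hkd, hkT⟩ := mem_pending.1 (mover_spec hk).1
    have hwf := run_wellFormed (A := A) (T := T) hc m
    rcases ih with ⟨b, R', hR', hL⟩ | ⟨hmem, hother, hd, hpos⟩
    · exact Or.inl ⟨b, R', hR', hL.step k⟩
    have hposi := run_pos A T c m i hd
    have hi0 := pos_add_opsBefore (hR i)
    set s := run A T c m with hs
    by_cases hki : k = i
    · subst hki
      by_cases hdec : (localStep s.cfg.mem (s.cfg.proc k)).loc = .decided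
      · obtain ⟨h1, h2⟩ := localStep_decided _ _ hd hdec
        refine Or.inl ⟨_, _, ?_, (hwf.locked h1 h2).step k⟩
        unfold ProcState.pos at hpos
        omega
      obtain ⟨-, hp⟩ := localStep_pos _ _ hdec
      rcases hpos.lt_or_eq with hlt | heq
      · refine Or.inr ⟨fun b ρ hρ => ?_, fun j hj => ?_, ?_, ?_⟩
        · rw [← Bool.not_eq_true, step_mem]
          rintro (h | ⟨h1, h2, h3⟩)
          · simp [hmem b ρ hρ] at h
          · simp [ProcState.pos, h1, h3, Loc.stage] at hlt
            omega
        · rw [step_proc_of_ne _ hj]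
          exact hother j hj
        · rwa [step_proc_self]
        · rw [step_proc_self, hp]
          omega
      · left
        have hst := (s.cfg.proc k).loc.stage_lt
        have heq' : 4 * (s.cfg.proc k).round + (s.cfg.proc k).loc.stage = 4 * R + 2 := heq
        have h1 : (s.cfg.proc k).round = R := by omega
        have h2 : (s.cfg.proc k).loc.stage = 2 := by omega
        have h3 : (s.cfg.proc k).loc = .writePref := by
          rcases hl : (s.cfg.proc k).loc with _ | v | _ | _ | _ <;> simp_all [Loc.stage]
        exact ⟨_, R, le_rfl, locked_of_lead h1 h3 hother hmem⟩
    · have hround : (s.cfg.proc k).round < R := by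
        rcases hother k hki with h | ⟨h1, h2⟩
        · exact h
        · exfalso
          have hposk := run_pos A T c m k hkd
          have hk0 := pos_add_opsBefore (hR k)
          rw [← hs, show (s.cfg.proc k).pos = 4 * R by simp [ProcState.pos, h1, h2, Loc.stage]]
            at hposk
          have hkc : s.count k = opsBefore (c.proc k) R := by omega
          -- The next operation of `k` would be its first in round `R`; the leader's next one is at
          -- most its third there and is scheduled strictly earlier, so `k` cannot be the mover.
          have hl := hlead k hkA hki
          have hle : T i (s.count i + 1) ≤ T i (opsBefore (c.proc i) R + 3) := hmono (by omega)
          have hip : i ∈ pending A T s :=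
            mem_pending.2 ⟨hiA, hd, (hle.trans_lt (hl.trans_le le_top)).ne⟩
          have := (mover_spec hk).2 i hip
          rw [hkc] at this
          exact absurd (this.trans hle) (not_le.2 hl)
      refine Or.inr ⟨fun b ρ hρ => ?_, fun j hj => ?_, ?_, ?_⟩
      · rw [← Bool.not_eq_true, step_mem]
        rintro (h | ⟨h1, h2, h3⟩)
        · simp [hmem b ρ hρ] at h
        · omega
      · simp only [step_proc]
        split_ifs with hjk
        · exact ProcState.Before.localStep hround _
        · exact hother j hj
      · rwa [step_proc_of_ne _ (Ne.symm hki)]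
      · rwa [step_proc_of_ne _ (Ne.symm hki)]

/-- A lead in round `R` makes the execution terminate by round `R + 1`. -/
theorem Leads.terminatesBy {A : Finset ℕ} {T : ℕ → ℕ → EReal} {c : Config} (hc : c.WellFormed)
    {R : ℕ} (hR : ∀ i, (c.proc i).round < R) (hA : ∀ i ∈ A, (c.proc i).loc ≠ .decided)
    (hmono : ∀ i ∈ A, Monotone (T i)) (h : Leads A T c R) :
    TerminatesBy A T c (R + 1) := by
  apply terminatesBy_of_round_le
  intro m k
  rcases h with ⟨i, hi, h⟩ | h
  · rcases locked_or_ahead hc hR hi (hA i hi) (hmono i hi) h m with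
      ⟨b, R', hR', hL⟩ | ⟨-, h1, -, h2⟩
    · exact (hL.round_le k).trans (by omega)
    · by_cases hk : k = i
      · subst hk
        unfold ProcState.pos at h2
        omega
      · rcases h1 k hk with h | ⟨h, -⟩ <;> omega
  · rcases round_le_of_no_start hR h m k with h | ⟨h, -⟩ <;> omega

theorem Leads.extraRounds_le {A : Finset ℕ} {T : ℕ → ℕ → EReal} {c : Config} (hc : c.WellFormed)
    {r k : ℕ} (hr : ∀ i, (c.proc i).round ≤ r) (hA : ∀ i ∈ A, (c.proc i).loc ≠ .decided)
    (hmono : ∀ i ∈ A, Monotone (T i)) (hk : 1 ≤ k) (h : Leads A T c (r + k)) :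
    extraRounds A T c r ≤ (k + 1 : ℕ) := by
  refine sInf_le ⟨k + 1, rfl, ?_⟩
  rw [← add_assoc]
  exact h.terminatesBy hc (fun i => (hr i).trans_lt (by omega)) hA hmono

/-! ## Lower tails of sums of independent variables -/

/-- A law whose support is a single point is a Dirac mass. Two support points can be separated by
trisecting the interval between them. -/
theorem exists_separated_of_ne_dirac (F : Measure ℝ) [IsProbabilityMeasure F]
    (h : ∀ x, F ≠ Measure.dirac x) :
    ∃ a b, a < b ∧ 0 < F.real (Set.Iic a) ∧ 0 < F.real (Set.Ici b) := by
  have key : ∃ x ∈ F.support, ∃ y ∈ F.support, x < y := by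
    obtain ⟨x, hx⟩ := Measure.nonempty_support (IsProbabilityMeasure.ne_zero F)
    by_contra! hxy
    have hsub : F.support ⊆ {x} := fun y hy =>
      le_antisymm (hxy x hx y hy) (hxy y hy x hx)
    apply h x
    have hae : (fun y => y) =ᵐ[F] fun _ => x := by
      filter_upwards [Measure.support_mem_ae (μ := F)] with y hy using hsub hy
    calc F = F.map (fun y => y) := Measure.map_id.symm
      _ = F.map (fun _ => x) := Measure.map_congr hae
      _ = Measure.dirac x := by rw [Measure.map_const]; simp
  obtain ⟨x, hx, y, hy, hxy⟩ := key
  refine ⟨(2 * x + y) / 3, (x + 2 * y) / 3, by linarith, ?_, ?_⟩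
  · exact ENNReal.toReal_pos
      ((Measure.mem_support_iff_forall x).1 hx _ (Iic_mem_nhds (by linarith))).ne'
      (measure_ne_top _ _)
  · exact ENNReal.toReal_pos
      ((Measure.mem_support_iff_forall y).1 hy _ (Ici_mem_nhds (by linarith))).ne'
      (measure_ne_top _ _)

theorem exists_Iic_pos (F : Measure ℝ) [IsProbabilityMeasure F] :
    ∃ x, 0 ≤ x ∧ 0 < F.real (Set.Iic x) := by
  obtain ⟨x, hx⟩ := Measure.nonempty_support (IsProbabilityMeasure.ne_zero F)
  refine ⟨|x| + 1, by positivity, ENNReal.toReal_pos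
      ((Measure.mem_support_iff_forall x).1 hx _ (Iic_mem_nhds ?_)).ne' (measure_ne_top _ _)⟩
  linarith [le_abs_self x]

section LowerTail

variable {Ω ι : Type*} [MeasurableSpace Ω] {μ : Measure Ω} [IsProbabilityMeasure μ]
  {Z : ι → Ω → ℝ}

/-- Replacing a large summand by a small one. -/
theorem swap_summand [DecidableEq ι] (hind : iIndepFun Z μ) (hm : ∀ i, Measurable (Z i))
    {I : Finset ι} {k : ι} (hk : k ∈ I) (a b s : ℝ) :
    μ.real {ω | Z k ω ≤ a} * μ.real {ω | ∑ i ∈ I, Z i ω ≤ s ∧ b ≤ Z k ω} ≤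
      μ.real {ω | ∑ i ∈ I, Z i ω ≤ s - (b - a)} := by
  have hsplit : ∀ ω, ∑ i ∈ I, Z i ω = ∑ i ∈ I.erase k, Z i ω + Z k ω := fun ω =>
    (Finset.sum_erase_add I (fun i => Z i ω) hk).symm
  have hi : IndepFun (∑ j ∈ I.erase k, Z j) (Z k) μ :=
    hind.indepFun_finsetSum_of_notMem hm (Finset.notMem_erase k I)
  have hprod := hi.measure_inter_preimage_eq_mul (Set.Iic (s - b)) (Set.Iic a) measurableSet_Iic
    measurableSet_Iic
  calc μ.real {ω | Z k ω ≤ a} * μ.real {ω | ∑ i ∈ I, Z i ω ≤ s ∧ b ≤ Z k ω}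
      ≤ μ.real {ω | Z k ω ≤ a} * μ.real ((∑ j ∈ I.erase k, Z j) ⁻¹' Set.Iic (s - b)) := by
        gcongr
        · exact measure_ne_top _ _
        · rintro ω ⟨h1, h2⟩
          rw [hsplit] at h1
          simp only [Set.mem_preimage, Finset.sum_apply, Set.mem_Iic]
          linarith
    _ = μ.real ((∑ j ∈ I.erase k, Z j) ⁻¹' Set.Iic (s - b) ∩ Z k ⁻¹' Set.Iic a) := by
        rw [measureReal_def, measureReal_def, measureReal_def, hprod, ENNReal.toReal_mul, mul_comm]
        rfl
    _ ≤ _ := by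
        apply measureReal_mono _ (measure_ne_top _ _)
        rintro ω ⟨h1, h2⟩
        simp only [Set.mem_preimage, Finset.sum_apply, Set.mem_Iic] at h1 h2
        simp only [Set.mem_ofPred_eq, hsplit]
        linarith

/-- Few large values are exponentially unlikely. -/
theorem count_large_le (hind : iIndepFun Z μ) (hm : ∀ i, Measurable (Z i))
    {K : Finset ι} {b β : ℝ} (hβ : 0 ≤ β) (hb : ∀ k ∈ K, β ≤ μ.real {ω | b ≤ Z k ω}) :
    μ.real {ω | ∑ k ∈ K, (Set.Ici b).indicator (fun _ => (1 : ℝ)) (Z k ω) ≤ β / 2 * K.card} ≤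
      Real.exp (-(β ^ 2 / 2 * K.card)) := by
  set g : ℝ → ℝ := (Set.Ici b).indicator fun _ => (1 : ℝ) with hg
  have hgm : Measurable g := measurable_const.indicator measurableSet_Ici
  have hg01 : ∀ x, g x ∈ Set.Icc (0 : ℝ) 1 := by
    intro x
    by_cases hx : x ∈ Set.Ici b <;> simp [hg, hx]
  have hint : ∀ k ∈ K, β ≤ ∫ ω, g (Z k ω) ∂μ := by
    intro k hk
    have : (fun ω => g (Z k ω)) = {ω | b ≤ Z k ω}.indicator fun _ => (1 : ℝ) := by
      ext ω; simp [hg, Set.indicator]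
    rw [this, integral_indicator_const _ (measurableSet_le measurable_const (hm k))]
    simpa using hb k hk
  set W : ι → Ω → ℝ := fun k ω => -g (Z k ω) - ∫ ω', -g (Z k ω') ∂μ with hW
  have hWind : iIndepFun W μ :=
    hind.comp (fun k x => -g x - ∫ ω', -g (Z k ω') ∂μ) fun k => hgm.neg.sub_const _
  have hsub : ∀ k ∈ K, HasSubgaussianMGF (W k) ((‖(0 : ℝ) - (-1)‖₊ / 2) ^ 2) μ := by
    intro k _
    apply hasSubgaussianMGF_of_mem_Icc (a := -1) (b := 0)
    · exact (hgm.comp (hm k)).neg.aemeasurable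
    · exact ae_of_all _ fun ω => ⟨neg_le_neg (hg01 _).2, neg_nonpos.2 (hg01 _).1⟩
  -- Hoeffding for the negated indicators, whose sub-Gaussian parameter is `1/4`: a deviation of `β
  -- / 2` per term gives the exponent `β ^ 2 / 2` per term.
  have := HasSubgaussianMGF.measure_sum_ge_le_of_iIndepFun hWind hsub
    (ε := β / 2 * K.card) (by positivity)
  refine (measureReal_mono ?_ (measure_ne_top _ _)).trans (this.trans (Real.exp_le_exp.2 ?_))
  · intro ω hω
    simp only [Set.mem_ofPred_eq, hW, Finset.sum_sub_distrib, Finset.sum_neg_distrib, integral_neg]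
      at hω ⊢
    have := Finset.card_nsmul_le_sum K _ _ hint
    simp only [nsmul_eq_mul] at this
    linarith
  · rcases K.eq_empty_or_nonempty with rfl | hK
    · simp
    · have : (0 : ℝ) < K.card := by exact_mod_cast hK.card_pos
      apply le_of_eq
      simp
      field_simp

/-- The lower tail decreases by at most a constant factor over a constant distance, up to an
exponentially small error. -/
theorem lower_tail_shift [DecidableEq ι] (hind : iIndepFun Z μ) (hm : ∀ i, Measurable (Z i))
    {I K : Finset ι} (hKI : K ⊆ I) (hK : K.Nonempty) {a b α β : ℝ} (hα : 0 ≤ α) (hβ : 0 < β)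
    (ha : ∀ k ∈ K, α ≤ μ.real {ω | Z k ω ≤ a}) (hb : ∀ k ∈ K, β ≤ μ.real {ω | b ≤ Z k ω}) (s : ℝ) :
    α * β / 2 * (μ.real {ω | ∑ i ∈ I, Z i ω ≤ s} - Real.exp (-(β ^ 2 / 2 * K.card))) ≤
      μ.real {ω | ∑ i ∈ I, Z i ω ≤ s - (b - a)} := by
  have hK0 : (0 : ℝ) < K.card := by exact_mod_cast hK.card_pos
  have hSm : Measurable fun ω => ∑ i ∈ I, Z i ω := Finset.measurable_sum _ fun i _ => hm i
  set E : ι → Set Ω := fun k => {ω | ∑ i ∈ I, Z i ω ≤ s ∧ b ≤ Z k ω} with hE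
  have hEm : ∀ k, MeasurableSet (E k) := fun k =>
    (measurableSet_le hSm measurable_const).inter (measurableSet_le measurable_const (hm k))
  set f : Ω → ℝ := fun ω => ∑ k ∈ K, (E k).indicator (fun _ => (1 : ℝ)) ω with hf
  have hfint : ∀ k ∈ K, Integrable ((E k).indicator fun _ => (1 : ℝ)) μ := fun k _ =>
    (integrable_const _).indicator (hEm k)
  -- Markov's inequality for the number of `k ∈ K` with `Z k ≥ b` on the event that the sum is at
  -- most `s`. Swapping bounds its expectation from above, and on that event the number is at least
  -- `β / 2 * K.card` outside the Hoeffding exception.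
  have hmarkov := mul_meas_ge_le_integral_of_nonneg (μ := μ) (f := f)
    (ae_of_all _ fun ω => Finset.sum_nonneg fun k _ => Set.indicator_nonneg (by simp) _)
    (integrable_finsetSum _ hfint) (β / 2 * K.card)
  rw [hf, integral_finsetSum _ hfint] at hmarkov
  simp only [integral_indicator_const _ (hEm _), smul_eq_mul, mul_one] at hmarkov
  have hsum : α * ∑ k ∈ K, μ.real (E k) ≤ K.card * μ.real {ω | ∑ i ∈ I, Z i ω ≤ s - (b - a)} := by
    rw [Finset.mul_sum, ← nsmul_eq_mul]
    apply Finset.sum_le_card_nsmul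
    intro k hk
    exact (mul_le_mul_of_nonneg_right (ha k hk) measureReal_nonneg).trans
      (swap_summand hind hm (hKI hk) a b s)
  have hcover : μ.real {ω | ∑ i ∈ I, Z i ω ≤ s} ≤
      μ.real {ω | β / 2 * K.card ≤ ∑ k ∈ K, (E k).indicator (fun _ => (1 : ℝ)) ω} +
        Real.exp (-(β ^ 2 / 2 * K.card)) := by
    refine le_trans ?_ (add_le_add le_rfl (count_large_le hind hm hβ.le hb))
    refine (measureReal_mono ?_ (measure_ne_top _ _)).trans (measureReal_union_le _ _)
    intro ω hω
    rcases le_total (β / 2 * K.card)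
      (∑ k ∈ K, (Set.Ici b).indicator (fun _ => (1 : ℝ)) (Z k ω)) with h | h
    · left
      refine h.trans (Finset.sum_le_sum fun k _ => ?_)
      have hω' : ∑ i ∈ I, Z i ω ≤ s := hω
      simp [Set.indicator, hE, hω']
    · exact Or.inr h
  set P := μ.real {ω | β / 2 * K.card ≤ ∑ k ∈ K, (E k).indicator (fun _ => (1 : ℝ)) ω}
  set Q := μ.real {ω | ∑ i ∈ I, Z i ω ≤ s - (b - a)}
  have h1 : α * (β / 2 * K.card * P) ≤ K.card * Q :=
    (mul_le_mul_of_nonneg_left hmarkov hα).trans hsum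
  have h2 : α * β / 2 * P ≤ Q := by
    refine le_of_mul_le_mul_left ?_ hK0
    linarith
  refine le_trans (mul_le_mul_of_nonneg_left ?_ (by positivity)) h2
  linarith

/-- Since the factor `α * β / 2` is at most `1`, earlier errors only shrink, and the `m` errors at
most add up. -/
theorem lower_tail_shift_iterate [DecidableEq ι] (hind : iIndepFun Z μ)
    (hm : ∀ i, Measurable (Z i))
    {I K : Finset ι} (hKI : K ⊆ I) (hK : K.Nonempty) {a b α β : ℝ} (hα : 0 ≤ α) (hβ : 0 < β)
    (ha : ∀ k ∈ K, α ≤ μ.real {ω | Z k ω ≤ a}) (hb : ∀ k ∈ K, β ≤ μ.real {ω | b ≤ Z k ω}) (s : ℝ)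
    (m : ℕ) :
    (α * β / 2) ^ m * μ.real {ω | ∑ i ∈ I, Z i ω ≤ s} - m * Real.exp (-(β ^ 2 / 2 * K.card)) ≤
      μ.real {ω | ∑ i ∈ I, Z i ω ≤ s - m * (b - a)} := by
  obtain ⟨k, hk⟩ := hK
  have hα1 : α ≤ 1 := (ha k hk).trans measureReal_le_one
  have hβ1 : β ≤ 1 := (hb k hk).trans measureReal_le_one
  have hκ : α * β / 2 ≤ 1 := by nlinarith
  have hκ0 : 0 ≤ α * β / 2 := by positivity
  induction m with
  | zero => simp
  | succ m ih =>
    have h := lower_tail_shift hind hm hKI ⟨k, hk⟩ hα hβ ha hb (s - m * (b - a))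
    have e : s - ((m + 1 : ℕ) : ℝ) * (b - a) = s - m * (b - a) - (b - a) := by push_cast; ring
    rw [e]
    refine le_trans ?_ h
    set κ := α * β / 2
    set η := Real.exp (-(β ^ 2 / 2 * K.card))
    have hη : 0 ≤ η := Real.exp_nonneg _
    have h3 := mul_le_mul_of_nonneg_left ih hκ0
    have h4 : κ * (m * η) ≤ m * η := mul_le_of_le_one_left (by positivity) hκ
    have h5 : κ * η ≤ η := mul_le_of_le_one_left hη hκ
    rw [pow_succ']
    push_cast
    nlinarith

end LowerTail

/-! ### A unique early process, thresholds, conditioning and the block length -/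

/-- If the events `a k` are independent and unlikely to occur, then with substantial probability
just one of them occurs, in the strong form `b i`. -/
theorem half_sum_le_measure_unique {Ω ι : Type*} [MeasurableSpace Ω] {μ : Measure Ω}
    [IsProbabilityMeasure μ] {A : Finset ι} {a b : ι → Set Ω}
    (ha : ∀ i ∈ A, MeasurableSet (a i)) (hb : ∀ i ∈ A, MeasurableSet (b i))
    (hba : ∀ i ∈ A, b i ⊆ a i)
    (hind : ∀ i ∈ A, ∀ k ∈ A, k ≠ i → μ.real (b i ∩ a k) = μ.real (b i) * μ.real (a k))
    (hsum : ∑ k ∈ A, μ.real (a k) ≤ 1 / 2) :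
    (∑ i ∈ A, μ.real (b i)) / 2 ≤
      μ.real {ω | ∃ i ∈ A, ω ∈ b i ∧ ∀ k ∈ A, k ≠ i → ω ∉ a k} := by
  classical
  set G : ι → Set Ω := fun i => b i \ ⋃ k ∈ A.erase i, a k with hG
  have hGm : ∀ i ∈ A, MeasurableSet (G i) := fun i hi =>
    (hb i hi).diff (Finset.measurableSet_biUnion _ fun k hk => ha k (Finset.mem_of_mem_erase hk))
  have hdisj : (A : Set ι).PairwiseDisjoint G := by
    intro i hi k hk hik
    rw [Function.onFun, Set.disjoint_left]
    rintro ω ⟨h1, -⟩ ⟨-, h2⟩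
    exact h2 (Set.mem_biUnion (Finset.mem_coe.2 (Finset.mem_erase.2 ⟨hik, hi⟩)) (hba i hi h1))
  have hunion := measureReal_biUnion_finset (μ := μ) hdisj hGm
  have hsub : (⋃ i ∈ A, G i) ⊆ {ω | ∃ i ∈ A, ω ∈ b i ∧ ∀ k ∈ A, k ≠ i → ω ∉ a k} := by
    intro ω hω
    simp only [Set.mem_iUnion] at hω
    obtain ⟨i, hi, h1, h2⟩ := hω
    exact ⟨i, hi, h1, fun k hk hki h =>
      h2 (Set.mem_biUnion (Finset.mem_coe.2 (Finset.mem_erase.2 ⟨hki, hk⟩)) h)⟩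
  refine le_trans ?_ (measureReal_mono hsub (measure_ne_top _ _))
  rw [hunion, Finset.sum_div]
  refine Finset.sum_le_sum fun i hi => ?_
  have h1 : μ.real (b i) ≤ μ.real (G i) + ∑ k ∈ A.erase i, μ.real (b i ∩ a k) := by
    refine le_trans (measureReal_mono ?_ (measure_ne_top _ _)) ((measureReal_union_le (G i)
      (⋃ k ∈ A.erase i, b i ∩ a k)).trans (add_le_add le_rfl (measureReal_biUnion_finset_le _ _)))
    intro ω hω
    by_cases h : ω ∈ ⋃ k ∈ A.erase i, a k
    · right
      simp only [Set.mem_iUnion] at h ⊢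
      obtain ⟨k, hk, h⟩ := h
      exact ⟨k, hk, hω, h⟩
    · exact Or.inl ⟨hω, h⟩
  have h2 : ∑ k ∈ A.erase i, μ.real (b i ∩ a k) ≤ μ.real (b i) * (1 / 2) := by
    rw [Finset.sum_congr rfl fun k hk => hind i hi k (Finset.mem_of_mem_erase hk)
      (Finset.ne_of_mem_erase hk), ← Finset.mul_sum]
    refine mul_le_mul_of_nonneg_left (le_trans ?_ hsum) measureReal_nonneg
    exact Finset.sum_le_sum_of_subset_of_nonneg (Finset.erase_subset _ _)
      fun _ _ _ => measureReal_nonneg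
  linarith

/-- Going down from `t₁` in steps of `d` replaces a continuity argument: `f` may jump, but some step
crosses the level `1/2`. -/
theorem exists_threshold {f : ℝ → ℝ} {d t₀ t₁ : ℝ} (hd : 0 < d) (h₀ : ∀ t < t₀, f t < 1 / 2)
    (h₁ : 1 / 2 ≤ f t₁) : ∃ t, 1 / 2 ≤ f t ∧ f (t - d) < 1 / 2 := by
  have hex : ∃ k : ℕ, f (t₁ - k * d) < 1 / 2 := by
    obtain ⟨k, hk⟩ := exists_nat_gt ((t₁ - t₀) / d)
    refine ⟨k, h₀ _ ?_⟩
    rw [div_lt_iff₀ hd] at hk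
    linarith
  classical
  have hk := Nat.find_spec hex
  rcases hk0 : Nat.find hex with _ | k
  · rw [hk0] at hk
    simp at hk
    linarith
  · refine ⟨t₁ - k * d, not_lt.1 (Nat.find_min hex (m := k) (by omega)), ?_⟩
    rw [hk0] at hk
    convert hk using 2
    push_cast
    ring

/-- A conditional bound on a probability, given an independent variable. -/
theorem measure_and_le_mul_of_indepFun {Ω α β : Type*} [MeasurableSpace Ω] {μ : Measure Ω}
    [IsProbabilityMeasure μ] [MeasurableSpace α] [MeasurableSpace β] {W : Ω → α} {V : Ω → β}
    (hW : Measurable W) (hV : Measurable V) (hind : IndepFun W V μ) {P : Set α}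
    (hP : MeasurableSet P) {G : Set (α × β)} (hG : MeasurableSet G) {q : ℝ≥0∞}
    (hq : ∀ ω', μ {ω | (W ω', V ω) ∈ G} ≤ q) :
    μ {ω | W ω ∈ P ∧ (W ω, V ω) ∈ G} ≤ q * μ {ω | W ω ∈ P} := by
  have hPG : MeasurableSet ((Prod.fst ⁻¹' P) ∩ G) := (measurable_fst hP).inter hG
  have h1 : μ {ω | W ω ∈ P ∧ (W ω, V ω) ∈ G} =
      ((μ.map W).prod (μ.map V)) ((Prod.fst ⁻¹' P) ∩ G) := by
    rw [← (indepFun_iff_map_prod_eq_prod_map_map hW.aemeasurable hV.aemeasurable).1 hind,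
      Measure.map_apply (hW.prodMk hV) hPG]
    rfl
  have : IsProbabilityMeasure (μ.map V) := Measure.isProbabilityMeasure_map hV.aemeasurable
  rw [h1, Measure.prod_apply hPG, lintegral_map (measurable_measure_prodMk_left hPG) hW]
  calc ∫⁻ ω', μ.map V (Prod.mk (W ω') ⁻¹' ((Prod.fst ⁻¹' P) ∩ G)) ∂μ
      ≤ ∫⁻ ω', (W ⁻¹' P).indicator (fun _ => q) ω' ∂μ := by
        apply lintegral_mono
        intro ω'
        by_cases h : W ω' ∈ P
        · simp only [Set.indicator, Set.mem_preimage, h, if_true]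
          refine le_trans ?_ (hq ω')
          rw [Measure.map_apply hV (measurable_prodMk_left hPG)]
          exact measure_mono fun ω hω => hω.2
        · have : Prod.mk (W ω') ⁻¹' ((Prod.fst ⁻¹' P) ∩ G) = ∅ := by
            ext v; simp [h]
          simp [this]
    _ = q * μ {ω | W ω ∈ P} := by
        rw [lintegral_indicator_const (hW hP)]
        rfl

theorem exists_block_length {ν K : ℝ} (hν : 0 < ν) (hK : 0 < K) :
    ∃ C : ℝ, 0 < C ∧ ∀ n : ℕ, 2 ≤ n →
      ∃ L : ℕ, 1 ≤ L ∧ (L : ℝ) ≤ C * Real.log n ∧ n * (K * Real.exp (-(ν * L))) ≤ 1 := by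
  have hl2 : 0 < Real.log 2 := Real.log_pos (by norm_num)
  -- For `n ≥ 2`, `Real.log n ≥ Real.log 2` lets multiples of `Real.log n` absorb `|Real.log K|` and
  -- the at most `2` lost by rounding up and adding one.
  refine ⟨(|Real.log K| / Real.log 2 + 1) / ν + 2 / Real.log 2, by positivity, fun n hn => ?_⟩
  have hn' : (2 : ℝ) ≤ n := by exact_mod_cast hn
  have hln : Real.log 2 ≤ Real.log n := Real.log_le_log (by norm_num) hn'
  set x := (|Real.log K| + Real.log n) / ν with hx
  have hx0 : 0 ≤ x := div_nonneg (by positivity) hν.le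
  refine ⟨⌈x⌉₊ + 1, by omega, ?_, ?_⟩
  · push_cast
    have h1 := (Nat.ceil_lt_add_one hx0).le
    have h2 : (2 : ℝ) ≤ 2 / Real.log 2 * Real.log n := by
      rw [div_mul_eq_mul_div, le_div_iff₀ hl2]
      linarith
    have h3 : |Real.log K| ≤ |Real.log K| / Real.log 2 * Real.log n := by
      rw [div_mul_eq_mul_div, le_div_iff₀ hl2]
      gcongr
    have h4 : x ≤ (|Real.log K| / Real.log 2 + 1) / ν * Real.log n := by
      rw [hx, div_mul_eq_mul_div]
      gcongr
      linarith
    linarith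
  · have h1 : x ≤ ((⌈x⌉₊ + 1 : ℕ) : ℝ) := (Nat.le_ceil x).trans (by push_cast; linarith)
    have h2 : |Real.log K| + Real.log n ≤ ν * ((⌈x⌉₊ + 1 : ℕ) : ℝ) := by
      rw [hx, div_le_iff₀ hν] at h1
      linarith
    calc n * (K * Real.exp (-(ν * ((⌈x⌉₊ + 1 : ℕ) : ℝ))))
        = Real.exp (Real.log n + Real.log K - ν * ((⌈x⌉₊ + 1 : ℕ) : ℝ)) := by
          rw [sub_eq_add_neg, Real.exp_add, Real.exp_add, Real.exp_log hK,
            Real.exp_log (by linarith)]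
          ring
      _ ≤ Real.exp 0 := Real.exp_le_exp.2 (by linarith [le_abs_self (Real.log K)])
      _ = 1 := Real.exp_zero

/-! ## One block of rounds of a noisy schedule -/

/-- Adding delays and failures to a starting time. -/
theorem sum_coe_add_halt {ι : Type*} (J : Finset ι) (y : ι → ℝ) (h : ι → EReal)
    (hh : ∀ j ∈ J, h j = 0 ∨ h j = ⊤) :
    (∀ j ∈ J, h j = 0) ∧ ∑ j ∈ J, ((y j : EReal) + h j) = ((∑ j ∈ J, y j : ℝ) : EReal) ∨
    (¬∀ j ∈ J, h j = 0) ∧ ∑ j ∈ J, ((y j : EReal) + h j) = ⊤ := by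
  classical
  induction J using Finset.induction_on with
  | empty => simp
  | insert k J hk ih =>
    rw [Finset.sum_insert hk, Finset.sum_insert hk]
    have ih := ih fun j hj => hh j (Finset.mem_insert_of_mem hj)
    rcases hh k (Finset.mem_insert_self k J) with h0 | h0
    · rcases ih with ⟨h1, h2⟩ | ⟨h1, h2⟩
      · left
        rw [h2, h0]
        refine ⟨by simpa [h0] using h1, by push_cast; simp⟩
      · right
        rw [h2, h0]
        exact ⟨fun h => h1 fun j hj => h j (Finset.mem_insert_of_mem hj), by simp⟩
    · right
      refine ⟨fun h => by simpa [h0] using h k (Finset.mem_insert_self k J), ?_⟩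
      rw [h0, EReal.coe_add_top]
      rcases ih with ⟨h1, h2⟩ | ⟨h1, h2⟩ <;> rw [h2]
      · exact EReal.top_add_coe _
      · rfl

/-! ### Operation times relative to a starting point, and independence of the schedule variables -/

/-- The time of the `k`-th operation of process `i` after its `N`-th one, if that occurs at
time `u`. -/
noncomputable def delayed {Ω : Type*} (Δ : ℕ → ℕ → ℝ) (X : ℕ → ℕ → Ω → ℝ) (H : ℕ → ℕ → Ω → EReal)
    (i N : ℕ) (u : EReal) (ω : Ω) (k : ℕ) : EReal :=
  u + ∑ j ∈ Finset.Ioc N (N + k), ((Δ i j : EReal) + (X i j ω : EReal) + H i j ω)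

theorem opTime_add {Ω : Type*} (Δ : ℕ → ℕ → ℝ) (X : ℕ → ℕ → Ω → ℝ) (H : ℕ → ℕ → Ω → EReal) (ω : Ω)
    (i N k : ℕ) : opTime Δ X H ω i (N + k) = delayed Δ X H i N (opTime Δ X H ω i N) ω k := by
  unfold delayed opTime
  have e : ∀ m, Finset.Icc 1 m = Finset.Ioc 0 m := fun m => by ext; simp; omega
  rw [e, e, add_assoc, Finset.sum_Ioc_consecutive _ (Nat.zero_le N) (Nat.le_add_right N k)]

/-- All noise variables (tag `false`) and failure variables (tag `true`). -/
def scheduleVar {Ω : Type*} (A : Finset ℕ) (X : ℕ → ℕ → Ω → ℝ) (H : ℕ → ℕ → Ω → EReal) :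
    (A × ℕ) ⊕ (A × ℕ) → Ω → EReal :=
  Sum.elim (fun (q : A × ℕ) (ω : Ω) => (X q.1 (q.2 + 1) ω : EReal))
    (fun (q : A × ℕ) (ω : Ω) => H q.1 (q.2 + 1) ω)

/-- The tag, process and operation of a variable. -/
def scheduleIndex (A : Finset ℕ) : (A × ℕ) ⊕ (A × ℕ) → Bool × ℕ × ℕ :=
  Sum.elim (fun q => (false, q.1, q.2 + 1)) (fun q => (true, q.1, q.2 + 1))

/-- The `σ`-algebra generated by the noise and failure variables with indices in `S`. -/
@[reducible] noncomputable def scheduleSigma {Ω : Type*} (A : Finset ℕ) (X : ℕ → ℕ → Ω → ℝ) (H : ℕ → ℕ → Ω → EReal)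
    (S : Set (Bool × ℕ × ℕ)) : MeasurableSpace Ω :=
  ⨆ q ∈ scheduleIndex A ⁻¹' S, MeasurableSpace.comap (scheduleVar A X H q) inferInstance

section

variable {Ω : Type*} {A : Finset ℕ} {X : ℕ → ℕ → Ω → ℝ} {H : ℕ → ℕ → Ω → EReal}

theorem measurable_noise_sigma {S : Set (Bool × ℕ × ℕ)} {i j : ℕ} (hi : i ∈ A) (hj : 1 ≤ j)
    (hS : (false, i, j) ∈ S) : Measurable[scheduleSigma A X H S] (X i j) := by
  obtain ⟨j, rfl⟩ := Nat.exists_eq_add_of_le' hj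
  have h1 : MeasurableSpace.comap (fun ω => (X i (j + 1) ω : EReal)) inferInstance ≤
      scheduleSigma A X H S :=
    le_iSup₂_of_le (f := fun q _ => MeasurableSpace.comap (scheduleVar A X H q) inferInstance)
      (Sum.inl (⟨i, hi⟩, j)) hS le_rfl
  have h2 : Measurable[scheduleSigma A X H S] fun ω => (X i (j + 1) ω : EReal) :=
    (comap_measurable _).mono h1 le_rfl
  exact h2.ereal_toReal

theorem measurable_halt_sigma {S : Set (Bool × ℕ × ℕ)} {i j : ℕ} (hi : i ∈ A) (hj : 1 ≤ j)
    (hS : (true, i, j) ∈ S) : Measurable[scheduleSigma A X H S] (H i j) := by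
  obtain ⟨j, rfl⟩ := Nat.exists_eq_add_of_le' hj
  have h1 : MeasurableSpace.comap (fun ω => H i (j + 1) ω) inferInstance ≤
      scheduleSigma A X H S :=
    le_iSup₂_of_le (f := fun q _ => MeasurableSpace.comap (scheduleVar A X H q) inferInstance)
      (Sum.inr (⟨i, hi⟩, j)) hS le_rfl
  exact (comap_measurable _).mono h1 le_rfl

theorem measurable_delayed_sigma {S : Set (Bool × ℕ × ℕ)} {Δ : ℕ → ℕ → ℝ} {i N k : ℕ} (hi : i ∈ A)
    (hS : ∀ b, ∀ j ∈ Finset.Ioc N (N + k), (b, i, j) ∈ S) (u : EReal) :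
    Measurable[scheduleSigma A X H S] fun ω => delayed Δ X H i N u ω k := by
  unfold delayed
  refine measurable_const.add (Finset.measurable_sum _ fun j hj => ?_)
  have hj1 : 1 ≤ j := by have := (Finset.mem_Ioc.1 hj).1; omega
  exact (measurable_const.add (measurable_noise_sigma hi hj1 (hS _ j hj)).coe_real_ereal).add
    (measurable_halt_sigma hi hj1 (hS _ j hj))

end

section

variable {Ω : Type*} [mΩ : MeasurableSpace Ω] {μ : Measure Ω}
  {F : OpType → Measure ℝ} {M p : ℝ} {c : Config} {A : Finset ℕ}
  {Δ : ℕ → ℕ → ℝ} {X : ℕ → ℕ → Ω → ℝ} {H : ℕ → ℕ → Ω → EReal}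

namespace IsNoisySchedule

theorem measurable_var (hS : IsNoisySchedule μ F M p c A Δ X H)
    (q : (A × ℕ) ⊕ (A × ℕ)) : Measurable (scheduleVar A X H q) := by
  rcases q with ⟨i, j⟩ | ⟨i, j⟩
  · exact (hS.measurable_noise i i.2 (j + 1) (by omega)).coe_real_ereal
  · exact hS.measurable_halt i i.2 (j + 1) (by omega)

theorem sigma_le (hS : IsNoisySchedule μ F M p c A Δ X H)
    (S : Set (Bool × ℕ × ℕ)) : scheduleSigma A X H S ≤ mΩ :=
  iSup₂_le fun q _ => (hS.measurable_var q).comap_le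

/-- Every independence used later, between processes, between noise and failures, and between past
and future, comes from disjoint index sets. -/
theorem indep_sigma (hS : IsNoisySchedule μ F M p c A Δ X H)
    {S T : Set (Bool × ℕ × ℕ)} (h : Disjoint S T) :
    Indep (scheduleSigma A X H S) (scheduleSigma A X H T) μ :=
  indep_iSup_of_disjoint (fun q => (hS.measurable_var q).comap_le) hS.indep (h.preimage _)

theorem real_inter (hS : IsNoisySchedule μ F M p c A Δ X H)
    {S T : Set (Bool × ℕ × ℕ)} (h : Disjoint S T) {s t : Set Ω}
    (hs : MeasurableSet[scheduleSigma A X H S] s) (ht : MeasurableSet[scheduleSigma A X H T] t) :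
    μ.real (s ∩ t) = μ.real s * μ.real t := by
  simp only [measureReal_def]
  rw [(Indep_iff _ _ μ).1 (hS.indep_sigma h) s t hs ht, ENNReal.toReal_mul]

theorem real_noise_le (hS : IsNoisySchedule μ F M p c A Δ X H)
    {i j : ℕ} (hi : i ∈ A) (hj : 1 ≤ j) {s : Set ℝ} (hs : MeasurableSet s) :
    μ.real (X i j ⁻¹' s) = (F (opType (c.proc i).loc j)).real s := by
  rw [← hS.law_noise i hi j hj, map_measureReal_apply (hS.measurable_noise i hi j hj) hs]

theorem real_no_halt [IsProbabilityMeasure μ] (hS : IsNoisySchedule μ F M p c A Δ X H)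
    (hp : p ∈ Set.Icc (0 : ℝ) 1) {i : ℕ} (hi : i ∈ A) (N k : ℕ) :
    μ.real {ω | ∀ j ∈ Finset.Ioc N (N + k), H i j ω = 0} = (1 - p) ^ k := by
  induction k with
  | zero => simp
  | succ k ih =>
    have e : {ω | ∀ j ∈ Finset.Ioc N (N + (k + 1)), H i j ω = 0} =
        {ω | ∀ j ∈ Finset.Ioc N (N + k), H i j ω = 0} ∩ {ω | H i (N + k + 1) ω = 0} := by
      ext ω
      simp only [Finset.mem_Ioc, Set.mem_inter_iff, Set.mem_ofPred_eq]
      refine ⟨fun h => ⟨fun j hj => h j (by omega), h _ (by omega)⟩, fun h j hj => ?_⟩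
      rcases eq_or_ne j (N + k + 1) with rfl | hne
      · exact h.2
      · exact h.1 j (by omega)
    have h1 : μ.real {ω | H i (N + k + 1) ω = 0} = 1 - p := by
      have hm : MeasurableSet {ω | H i (N + k + 1) ω = ⊤} :=
        hS.measurable_halt i hi (N + k + 1) (by omega) (measurableSet_singleton ⊤)
      have : {ω | H i (N + k + 1) ω = 0} = {ω | H i (N + k + 1) ω = ⊤}ᶜ := by
        ext ω
        rcases hS.halt_eq i hi (N + k + 1) (by omega) ω with h | h <;> simp [h]
      rw [this, probReal_compl_eq_one_sub hm, measureReal_def,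
        hS.prob_halt i hi (N + k + 1) (by omega), ENNReal.toReal_ofReal hp.1]
    rw [e, hS.real_inter (S := {q | q.2.2 ≤ N + k}) (T := {q | N + k < q.2.2}), ih, h1, pow_succ]
    · exact Set.disjoint_left.2 fun q h1 h2 => (not_lt.2 (show q.2.2 ≤ N + k from h1)) h2
    · have : {ω | ∀ j ∈ Finset.Ioc N (N + k), H i j ω = 0} =
          ⋂ j ∈ Finset.Ioc N (N + k), H i j ⁻¹' {0} := by ext; simp
      rw [this]
      refine Finset.measurableSet_biInter _ fun j hj => ?_
      have hj' := Finset.mem_Ioc.1 hj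
      exact measurable_halt_sigma hi (by omega) hj'.2 (measurableSet_singleton 0)
    · exact measurable_halt_sigma hi (by omega) (Nat.lt_succ_self _) (measurableSet_singleton 0)

theorem delayed_cases (hS : IsNoisySchedule μ F M p c A Δ X H)
    {i : ℕ} (hi : i ∈ A) (N k : ℕ) (x : ℝ) (ω : Ω) :
    (∀ j ∈ Finset.Ioc N (N + k), H i j ω = 0) ∧ delayed Δ X H i N x ω k =
      ((x + ∑ j ∈ Finset.Ioc N (N + k), Δ i j + ∑ j ∈ Finset.Ioc N (N + k), X i j ω : ℝ) : EReal) ∨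
    (¬∀ j ∈ Finset.Ioc N (N + k), H i j ω = 0) ∧ delayed Δ X H i N x ω k = ⊤ := by
  have := sum_coe_add_halt (Finset.Ioc N (N + k)) (fun j => Δ i j + X i j ω) (fun j => H i j ω)
    fun j hj => hS.halt_eq i hi j (by have := (Finset.mem_Ioc.1 hj).1; omega) ω
  simp only [EReal.coe_add] at this
  unfold delayed
  rcases this with ⟨h1, h2⟩ | ⟨h1, h2⟩
  · refine Or.inl ⟨h1, ?_⟩
    rw [h2, ← EReal.coe_add, Finset.sum_add_distrib, add_assoc]
  · refine Or.inr ⟨h1, ?_⟩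
    rw [h2, EReal.coe_add_top]

theorem delayed_le_iff (hS : IsNoisySchedule μ F M p c A Δ X H)
    {i : ℕ} (hi : i ∈ A) (N k : ℕ) (x t : ℝ) (ω : Ω) :
    delayed Δ X H i N x ω k ≤ t ↔ (∀ j ∈ Finset.Ioc N (N + k), H i j ω = 0) ∧
      ∑ j ∈ Finset.Ioc N (N + k), X i j ω ≤ t - x - ∑ j ∈ Finset.Ioc N (N + k), Δ i j := by
  rcases hS.delayed_cases hi N k x ω with ⟨h1, h2⟩ | ⟨h1, h2⟩ <;> rw [h2]
  · rw [EReal.coe_le_coe_iff]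
    constructor
    · intro h
      exact ⟨h1, by linarith⟩
    · intro h
      linarith [h.2]
  · exact iff_of_false (by simp) fun h => h1 h.1

theorem delayed_top (hS : IsNoisySchedule μ F M p c A Δ X H)
    (i : ℕ) (hi : i ∈ A) (N k : ℕ) (ω : Ω) : delayed Δ X H i N ⊤ ω k = ⊤ := by
  have := sum_coe_add_halt (Finset.Ioc N (N + k)) (fun j => Δ i j + X i j ω) (fun j => H i j ω)
    fun j hj => hS.halt_eq i hi j (by have := (Finset.mem_Ioc.1 hj).1; omega) ω
  simp only [EReal.coe_add] at this
  unfold delayed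
  rcases this with ⟨-, h2⟩ | ⟨-, h2⟩ <;> rw [h2]
  · exact EReal.top_add_coe _
  · rfl

theorem ae_nonneg (hS : IsNoisySchedule μ F M p c A Δ X H)
    (hnonneg : ∀ π, F π (Set.Iio 0) = 0) :
    ∀ᵐ ω ∂μ, ∀ i ∈ A, ∀ j, 1 ≤ j → 0 ≤ X i j ω := by
  rw [Filter.eventually_all_finset]
  intro i hi
  rw [ae_all_iff]
  intro j
  by_cases hj : 1 ≤ j
  swap
  · exact ae_of_all _ fun _ h => absurd h hj
  suffices ∀ᵐ ω ∂μ, 0 ≤ X i j ω by filter_upwards [this] with ω hω _ using hω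
  rw [ae_iff]
  have : {ω | ¬0 ≤ X i j ω} = X i j ⁻¹' Set.Iio 0 := by ext; simp
  rw [this, ← Measure.map_apply (hS.measurable_noise i hi j hj) measurableSet_Iio,
    hS.law_noise i hi j hj, hnonneg]

theorem le_delayed (hS : IsNoisySchedule μ F M p c A Δ X H)
    {i : ℕ} (hi : i ∈ A) (N k : ℕ) (u : EReal) {ω : Ω}
    (hω : ∀ i ∈ A, ∀ j, 1 ≤ j → 0 ≤ X i j ω) : u ≤ delayed Δ X H i N u ω k := by
  unfold delayed
  refine le_add_of_nonneg_right (Finset.sum_nonneg fun j hj => ?_)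
  have hj1 : 1 ≤ j := by have := (Finset.mem_Ioc.1 hj).1; omega
  have h1 : (0 : EReal) ≤ H i j ω := by
    rcases hS.halt_eq i hi j hj1 ω with h | h <;> simp [h]
  have h2 : (0 : EReal) ≤ Δ i j := by exact_mod_cast (hS.delay_mem i hi j hj1).1
  have h3 : (0 : EReal) ≤ X i j ω := by exact_mod_cast hω i hi j hj1
  positivity

theorem measurable_delayed (hS : IsNoisySchedule μ F M p c A Δ X H) {i : ℕ} (hi : i ∈ A) (N k : ℕ)
    (u : EReal) : Measurable fun ω => delayed Δ X H i N u ω k :=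
  (measurable_delayed_sigma (S := Set.univ) hi (fun _ _ _ => Set.mem_univ _) u).mono
    (hS.sigma_le _) le_rfl

end IsNoisySchedule

end

theorem sum_Ioc_eq_sum_range {β : Type*} [AddCommMonoid β] (f : ℕ → β) (N k : ℕ) :
    ∑ j ∈ Finset.Ioc N (N + k), f j = ∑ q ∈ Finset.range k, f (N + q + 1) := by
  induction k with
  | zero => simp
  | succ k ih =>
    rw [← add_assoc, Finset.sum_Ioc_succ_top (by omega), ih, Finset.sum_range_succ]

section

variable {Ω : Type*} {A : Finset ℕ} {X : ℕ → ℕ → Ω → ℝ} {H : ℕ → ℕ → Ω → EReal}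

theorem measurableSet_no_halt {i : ℕ} (hi : i ∈ A) (N k : ℕ) :
    MeasurableSet[scheduleSigma A X H {q | q.1 = true}]
      {ω | ∀ j ∈ Finset.Ioc N (N + k), H i j ω = 0} := by
  have : {ω | ∀ j ∈ Finset.Ioc N (N + k), H i j ω = 0} =
      ⋂ j ∈ Finset.Ioc N (N + k), H i j ⁻¹' {0} := by ext; simp
  rw [this]
  refine Finset.measurableSet_biInter _ fun j hj => ?_
  have hj' := Finset.mem_Ioc.1 hj
  have h : Measurable[scheduleSigma A X H {q | q.1 = true}] (H i j) :=
    measurable_halt_sigma hi (by omega) rfl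
  exact h (measurableSet_singleton 0)

theorem measurableSet_sum_noise_le {S : Set (Bool × ℕ × ℕ)} {i : ℕ} (hi : i ∈ A) (N k : ℕ)
    (hS : ∀ j ∈ Finset.Ioc N (N + k), (false, i, j) ∈ S) (s : ℝ) :
    MeasurableSet[scheduleSigma A X H S]
      {ω | ∑ j ∈ Finset.Ioc N (N + k), X i j ω ≤ s} := by
  refine measurableSet_le (Finset.measurable_sum _ fun j hj => ?_) measurable_const
  have hj' := Finset.mem_Ioc.1 hj
  exact measurable_noise_sigma hi (by omega) (hS j hj)

end

section

variable {Ω : Type*} [mΩ : MeasurableSpace Ω] {μ : Measure Ω} [IsProbabilityMeasure μ]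
  {F : OpType → Measure ℝ} {M p : ℝ} {c : Config} {A : Finset ℕ}
  {Δ : ℕ → ℕ → ℝ} {X : ℕ → ℕ → Ω → ℝ} {H : ℕ → ℕ → Ω → EReal}

namespace IsNoisySchedule

/-- The summands available for swapping are the first reads of the `l + 1` rounds; all other
operations may have arbitrary noise. The congruence on `N` says that counting starts at the
beginning of a round. -/
theorem lower_tail_noise (hS : IsNoisySchedule μ F M p c A Δ X H) {i : ℕ} (hi : i ∈ A) {N : ℕ}
    (hN : ((c.proc i).loc.stage + N) % 4 = 0) {a b α β : ℝ} (hα : 0 ≤ α)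
    (ha : α ≤ (F .read).real (Set.Iic a)) (hβ : 0 < β) (hb : β ≤ (F .read).real (Set.Ici b))
    (l m : ℕ) (s : ℝ) :
    (α * β / 2) ^ m * μ.real {ω | ∑ j ∈ Finset.Ioc N (N + (4 * l + 1)), X i j ω ≤ s} -
        m * Real.exp (-(β ^ 2 / 2 * (l + 1 : ℕ))) ≤
      μ.real {ω | ∑ j ∈ Finset.Ioc N (N + (4 * l + 1)), X i j ω ≤ s - m * (b - a)} := by
  have hind : iIndepFun (fun (q : ℕ) (ω : Ω) => X i (N + q + 1) ω) μ := by
    have hg : Function.Injective fun q : ℕ => (Sum.inl (⟨i, hi⟩, N + q) : (A × ℕ) ⊕ (A × ℕ)) := by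
      intro q q' h
      simpa using h
    exact (hS.indep.precomp hg).comp (fun _ => EReal.toReal) fun _ => measurable_ereal_toReal
  have hread : ∀ q, opType (c.proc i).loc (N + 4 * q + 1) = .read := by
    intro q
    unfold opType
    rw [if_neg (by omega)]
  set K : Finset ℕ := (Finset.range (l + 1)).image (4 * ·) with hK
  have hcard : K.card = l + 1 := by
    rw [hK, Finset.card_image_of_injective _ fun x y h => by simpa using h, Finset.card_range]
  have hKI : K ⊆ Finset.range (4 * l + 1) := by
    intro x hx
    simp only [hK, Finset.mem_image, Finset.mem_range] at hx ⊢
    omega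
  have hne : K.Nonempty := Finset.card_pos.1 (by omega)
  have h1 : ∀ k ∈ K, α ≤ μ.real {ω | X i (N + k + 1) ω ≤ a} := by
    intro k hk
    obtain ⟨q, -, rfl⟩ := Finset.mem_image.1 hk
    refine ha.trans_eq ?_
    rw [← hread q, ← hS.real_noise_le hi (by omega) measurableSet_Iic]
    rfl
  have h2 : ∀ k ∈ K, β ≤ μ.real {ω | b ≤ X i (N + k + 1) ω} := by
    intro k hk
    obtain ⟨q, -, rfl⟩ := Finset.mem_image.1 hk
    refine hb.trans_eq ?_
    rw [← hread q, ← hS.real_noise_le hi (by omega) measurableSet_Ici]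
    rfl
  have := lower_tail_shift_iterate hind (fun q => hS.measurable_noise i hi _ (by omega)) hKI hne hα
    hβ h1 h2 s m
  rw [hcard] at this
  simpa only [sum_Ioc_eq_sum_range] using this

/-- Survival and timing are independent, so failures contribute only the factor `(1 - p) ^ k`. -/
theorem real_delayed_le (hS : IsNoisySchedule μ F M p c A Δ X H) (hp : p ∈ Set.Icc (0 : ℝ) 1)
    {i : ℕ} (hi : i ∈ A) (N k : ℕ) (x t : ℝ) :
    μ.real {ω | delayed Δ X H i N x ω k ≤ t} = (1 - p) ^ k *
      μ.real {ω | ∑ j ∈ Finset.Ioc N (N + k), X i j ω ≤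
        t - x - ∑ j ∈ Finset.Ioc N (N + k), Δ i j} := by
  simp only [hS.delayed_le_iff hi]
  rw [Set.ofPred_and, hS.real_inter (S := {q | q.1 = true}) (T := {q | q.1 = false}) _
    (measurableSet_no_halt hi N k) (measurableSet_sum_noise_le hi N k (fun _ _ => rfl) _),
    hS.real_no_halt hp hi]
  exact Set.disjoint_left.2 fun q h1 h2 => by
    have h1 : q.1 = true := h1
    have h2 : q.1 = false := h2
    simp [h1] at h2

/-- With a probability comparable to that of starting a round by time `t`, a process finishes the
write of that round some time before `t`. -/
theorem real_finish_write (hS : IsNoisySchedule μ F M p c A Δ X H) (hp : p ∈ Set.Icc (0 : ℝ) 1)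
    (hp2 : p ≤ 1 / 2)
    {i : ℕ} (hi : i ∈ A) {N : ℕ}
    (hN : ((c.proc i).loc.stage + N) % 4 = 0) {a b α β x₀ γ : ℝ} (hα : 0 ≤ α)
    (ha : α ≤ (F .read).real (Set.Iic a)) (hβ : 0 < β) (hb : β ≤ (F .read).real (Set.Ici b))
    (hx₀ : 0 ≤ x₀) (hγ : 0 ≤ γ) (hF : ∀ π, γ ≤ (F π).real (Set.Iic x₀))
    {l m : ℕ} {d η : ℝ} (hm : d + 2 * M + 2 * x₀ ≤ m * (b - a)) (hη0 : 0 ≤ η)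
    (hη : m * Real.exp (-(β ^ 2 / 2 * (l + 1 : ℕ))) ≤ (α * β / 2) ^ m * η)
    {u : EReal} (hu : u ≠ ⊥) (t : ℝ) :
    γ ^ 2 * (α * β / 2) ^ m / 4 * (μ.real {ω | delayed Δ X H i N u ω (4 * l + 1) ≤ t} - η) ≤
      μ.real {ω | delayed Δ X H i N u ω (4 * l + 3) ≤ (t - d : ℝ) ∧
        delayed Δ X H i N u ω (4 * l + 1) ≤ (t - d : ℝ)} := by
  have hκ0 : 0 ≤ (α * β / 2) ^ m := by positivity
  induction u using EReal.rec with
  | bot => exact absurd rfl hu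
  | top =>
    simp only [hS.delayed_top i hi]
    have : {ω : Ω | (⊤ : EReal) ≤ (t : EReal)} = ∅ := by ext; simp
    rw [this, measureReal_empty]
    refine le_trans ?_ measureReal_nonneg
    exact mul_nonpos_of_nonneg_of_nonpos (by positivity) (by linarith)
  | coe x =>
    rw [hS.real_delayed_le hp hi]
    set D := ∑ j ∈ Finset.Ioc N (N + (4 * l + 1)), Δ i j
    set s := t - x - D with hs
    set f := μ.real {ω | ∑ j ∈ Finset.Ioc N (N + (4 * l + 1)), X i j ω ≤ s}
    have htail := hS.lower_tail_noise hi hN hα ha hβ hb l m s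
    set G : Set Ω := {ω | ∀ j ∈ Finset.Ioc N (N + (4 * l + 3)), H i j ω = 0} with hG
    set E : Set Ω := {ω | ∑ j ∈ Finset.Ioc N (N + (4 * l + 1)), X i j ω ≤ s - m * (b - a)} with hE
    set E₁ : Set Ω := X i (N + (4 * l + 1) + 1) ⁻¹' Set.Iic x₀ with hE₁
    set E₂ : Set Ω := X i (N + (4 * l + 2) + 1) ⁻¹' Set.Iic x₀ with hE₂
    have hmE : MeasurableSet[scheduleSigma A X H {q | q.1 = false ∧ q.2.2 ≤ N + (4 * l + 1)}] E :=
      measurableSet_sum_noise_le (S := {q | q.1 = false ∧ q.2.2 ≤ N + (4 * l + 1)}) hi _ _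
        (fun j hj => ⟨rfl, (Finset.mem_Ioc.1 hj).2⟩) _
    have hmE₁ : ∀ S : Set (Bool × ℕ × ℕ), (false, i, N + (4 * l + 1) + 1) ∈ S →
        MeasurableSet[scheduleSigma A X H S] E₁ := fun S hS =>
      measurable_noise_sigma hi (by omega) hS measurableSet_Iic
    have hmE₂ : ∀ S : Set (Bool × ℕ × ℕ), (false, i, N + (4 * l + 2) + 1) ∈ S →
        MeasurableSet[scheduleSigma A X H S] E₂ := fun S hS =>
      measurable_noise_sigma hi (by omega) hS measurableSet_Iic
    have hmE' : MeasurableSet[scheduleSigma A X H {q | q.1 = false}] E :=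
      measurableSet_sum_noise_le hi _ _ (fun j hj => rfl) _
    have e1 : μ.real (G ∩ (E ∩ (E₁ ∩ E₂))) =
        μ.real G * (μ.real E * (μ.real E₁ * μ.real E₂)) := by
      rw [hS.real_inter (S := {q | q.1 = true}) (T := {q | q.1 = false}) _
          (measurableSet_no_halt hi N _)
          (MeasurableSet.inter hmE' (MeasurableSet.inter (hmE₁ _ rfl) (hmE₂ _ rfl))),
        hS.real_inter (S := {q | q.1 = false ∧ q.2.2 ≤ N + (4 * l + 1)})
          (T := {q | N + (4 * l + 1) < q.2.2}) _ hmE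
          (MeasurableSet.inter (hmE₁ _ (by simp)) (hmE₂ _ (by simp))),
        hS.real_inter (S := {q | q.2.2 = N + (4 * l + 1) + 1})
          (T := {q | q.2.2 = N + (4 * l + 2) + 1}) _ (hmE₁ _ (by simp)) (hmE₂ _ (by simp))]
      · exact Set.disjoint_left.2 fun q h1 h2 => by
          have h1 : q.2.2 = N + (4 * l + 1) + 1 := h1
          have h2 : q.2.2 = N + (4 * l + 2) + 1 := h2
          omega
      · exact Set.disjoint_left.2 fun q h1 h2 => by
          have h1 : q.2.2 ≤ N + (4 * l + 1) := h1.2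
          have h2 : N + (4 * l + 1) < q.2.2 := h2
          omega
      · exact Set.disjoint_left.2 fun q h1 h2 => by
          have h1 : q.1 = true := h1
          have h2 : q.1 = false := h2
          simp [h1] at h2
    have hM : ∀ j, 1 ≤ j → Δ i j ≤ M := fun j hj => (hS.delay_mem i hi j hj).2
    have hM0 : 0 ≤ M := (hS.delay_mem i hi 1 le_rfl).1.trans (hM 1 le_rfl)
    -- The shift `m * (b - a)` pays for the lead time `d` and for the second read and the write,
    -- each of which costs at most `M + x₀`.
    have hsub : G ∩ (E ∩ (E₁ ∩ E₂)) ⊆ {ω | delayed Δ X H i N x ω (4 * l + 3) ≤ (t - d : ℝ) ∧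
        delayed Δ X H i N x ω (4 * l + 1) ≤ (t - d : ℝ)} := by
      rintro ω ⟨hωG, hωE, hω1, hω2⟩
      have hωE : ∑ j ∈ Finset.Ioc N (N + (4 * l + 1)), X i j ω ≤ s - m * (b - a) := hωE
      have hω1 : X i (N + (4 * l + 1) + 1) ω ≤ x₀ := hω1
      have hω2 : X i (N + (4 * l + 2) + 1) ω ≤ x₀ := hω2
      have h1 := hM (N + (4 * l + 1) + 1) (by omega)
      have h2 := hM (N + (4 * l + 2) + 1) (by omega)
      have esum : ∀ g : ℕ → ℝ, ∑ j ∈ Finset.Ioc N (N + (4 * l + 3)), g j =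
          ∑ j ∈ Finset.Ioc N (N + (4 * l + 1)), g j + g (N + (4 * l + 1) + 1) +
            g (N + (4 * l + 2) + 1) := by
        intro g
        rw [show N + (4 * l + 3) = N + (4 * l + 1) + 1 + 1 by ring,
          Finset.sum_Ioc_succ_top (by omega), Finset.sum_Ioc_succ_top (by omega)]
        rfl
      refine ⟨(hS.delayed_le_iff hi _ _ _ _ _).2 ⟨hωG, ?_⟩,
        (hS.delayed_le_iff hi _ _ _ _ _).2 ⟨fun j hj => hωG j ?_, ?_⟩⟩
      · rw [esum, esum]
        linarith
      · rw [Finset.mem_Ioc] at hj ⊢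
        omega
      · linarith
    refine le_trans ?_ (measureReal_mono hsub (measure_ne_top _ _))
    rw [e1, hG, hS.real_no_halt hp hi, hE₁, hE₂, hS.real_noise_le hi (by omega) measurableSet_Iic,
      hS.real_noise_le hi (by omega) measurableSet_Iic]
    have hq0 : 0 ≤ 1 - p := by linarith [hp.2]
    have hq1 : (1 - p) ^ (4 * l + 1) ≤ 1 := pow_le_one₀ hq0 (by linarith [hp.1])
    set Q := (1 - p) ^ (4 * l + 1) with hQ
    have hQ0 : 0 ≤ Q := by positivity
    -- Surviving the two further operations costs at most a factor `4`, as `p ≤ 1 / 2`.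
    have hq2 : Q / 4 ≤ (1 - p) ^ (4 * l + 3) := by
      rw [show 4 * l + 3 = (4 * l + 1) + 2 by ring, pow_add, ← hQ]
      have : 1 / 4 ≤ (1 - p) ^ 2 := by nlinarith
      nlinarith
    have hκf : (α * β / 2) ^ m * (f - η) ≤ μ.real E := by linarith
    have hγ2 : γ ^ 2 ≤ (F (opType (c.proc i).loc (N + (4 * l + 1) + 1))).real (Set.Iic x₀) *
        (F (opType (c.proc i).loc (N + (4 * l + 2) + 1))).real (Set.Iic x₀) := by
      rw [sq]
      exact mul_le_mul (hF _) (hF _) hγ (hγ.trans (hF _))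
    calc γ ^ 2 * (α * β / 2) ^ m / 4 * (Q * f - η)
        ≤ γ ^ 2 * (α * β / 2) ^ m / 4 * (Q * (f - η)) := by
          gcongr
          nlinarith
      _ = Q / 4 * ((α * β / 2) ^ m * (f - η) * γ ^ 2) := by ring
      _ ≤ Q / 4 * (μ.real E * γ ^ 2) := by gcongr
      _ ≤ _ := by
          gcongr

end IsNoisySchedule

end

/-! ### A lead at the end of one block has constant probability -/

/-- Counting operations of process `i` from its `N i`-th one, at time `u i`: some process executes
operation `4 * l + 3` before all others execute operation `4 * l + 1`, or all halt before that. -/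
def BlockLead {Ω : Type*} (A : Finset ℕ) (Δ : ℕ → ℕ → ℝ) (X : ℕ → ℕ → Ω → ℝ)
    (H : ℕ → ℕ → Ω → EReal) (N : ℕ → ℕ) (l : ℕ) (u : ℕ → EReal) (ω : Ω) : Prop :=
  (∃ i ∈ A, ∀ k ∈ A, k ≠ i →
    delayed Δ X H i (N i) (u i) ω (4 * l + 3) < delayed Δ X H k (N k) (u k) ω (4 * l + 1)) ∨
  ∀ i ∈ A, delayed Δ X H i (N i) (u i) ω (4 * l + 1) = ⊤

section

variable {Ω : Type*} [mΩ : MeasurableSpace Ω] {μ : Measure Ω} [IsProbabilityMeasure μ]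
  {F : OpType → Measure ℝ} {M p : ℝ} {c : Config} {A : Finset ℕ}
  {Δ : ℕ → ℕ → ℝ} {X : ℕ → ℕ → Ω → ℝ} {H : ℕ → ℕ → Ω → EReal}

/-- If every finite bound is exceeded by all variables with probability at least `1 / 2`, then so is
`⊤` attained. -/
theorem half_le_all_top {ι : Type*} {A : Finset ι} {Y : ι → Ω → EReal}
    (hY : ∀ i ∈ A, Measurable (Y i))
    (h : ∀ t : ℝ, ∑ i ∈ A, μ.real {ω | Y i ω ≤ t} < 1 / 2) :
    1 / 2 ≤ μ.real {ω | ∀ i ∈ A, Y i ω = ⊤} := by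
  set E : ℕ → Set Ω := fun n => (⋃ i ∈ A, {ω | Y i ω ≤ ((n : ℝ) : EReal)})ᶜ with hE
  have hEm : ∀ n, MeasurableSet (E n) := fun n =>
    (Finset.measurableSet_biUnion _ fun i hi => measurableSet_le (hY i hi) measurable_const).compl
  have hanti : Antitone E := by
    intro n n' hn
    apply Set.compl_subset_compl.2
    refine Set.iUnion₂_mono fun i _ ω hω => ?_
    have hω : Y i ω ≤ ((n : ℝ) : EReal) := hω
    exact hω.trans (by exact_mod_cast hn)
  have hP : ∀ n, 1 / 2 ≤ μ.real (E n) := by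
    intro n
    rw [hE, probReal_compl_eq_one_sub (hEm n).of_compl]
    have := measureReal_biUnion_finset_le (μ := μ) A fun i => {ω | Y i ω ≤ ((n : ℝ) : EReal)}
    have := h n
    linarith
  have hI : ⋂ n, E n ⊆ {ω | ∀ i ∈ A, Y i ω = ⊤} := by
    intro ω hω i hi
    by_contra hne
    obtain ⟨x, hx⟩ := EReal.lt_iff_exists_real_btwn.1 (lt_top_iff_ne_top.2 hne)
    obtain ⟨n, hn⟩ := exists_nat_ge x
    have := Set.mem_iInter.1 hω n
    apply this
    simp only [Set.mem_iUnion]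
    exact ⟨i, hi, hx.1.le.trans (by exact_mod_cast hn)⟩
  have hlim : Filter.Tendsto (fun n => μ.real (E n)) Filter.atTop (nhds (μ.real (⋂ n, E n))) :=
    (ENNReal.tendsto_toReal (measure_ne_top _ _)).comp
      (tendsto_measure_iInter_atTop (fun n => (hEm n).nullMeasurableSet) hanti
        ⟨0, measure_ne_top _ _⟩)
  exact (ge_of_tendsto' hlim hP).trans (measureReal_mono hI (measure_ne_top _ _))

namespace IsNoisySchedule

/-- The lower bound depends on neither the number of processes nor the times `u`; the size of `A`
enters only through the required block length `hl`. Allowing `u i = ⊤` covers processes that have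
already halted. -/
theorem blockLead (hS : IsNoisySchedule μ F M p c A Δ X H) (hp : p ∈ Set.Icc (0 : ℝ) 1)
    (hnonneg : ∀ π, F π (Set.Iio 0) = 0) (hA : A.Nonempty)
    {N : ℕ → ℕ} (hN : ∀ i ∈ A, ((c.proc i).loc.stage + N i) % 4 = 0) {a b α β x₀ γ : ℝ}
    (hα : 0 < α) (ha : α ≤ (F .read).real (Set.Iic a)) (hβ : 0 < β)
    (hb : β ≤ (F .read).real (Set.Ici b)) (hprob : ∀ π, IsProbabilityMeasure (F π))
    (hx₀ : 0 ≤ x₀) (hγ : 0 ≤ γ) (hF : ∀ π, γ ≤ (F π).real (Set.Iic x₀))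
    {l m : ℕ} {d : ℝ} (hd : 0 < d) (hm : d + 2 * M + 2 * x₀ ≤ m * (b - a))
    (hl : A.card * (4 * (m + 1) / (α * β / 2) ^ m * Real.exp (-(β ^ 2 / 2 * (l + 1 : ℕ)))) ≤ 1)
    {u : ℕ → EReal} (hu : ∀ i ∈ A, u i ≠ ⊥) :
    γ ^ 2 * (α * β / 2) ^ m / 32 ≤ μ.real {ω | BlockLead A Δ X H N l u ω} := by
  have hα1 : α ≤ 1 := ha.trans measureReal_le_one
  have hβ1 : β ≤ 1 := hb.trans measureReal_le_one
  have hγ1 : γ ≤ 1 := (hF .read).trans measureReal_le_one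
  have hκ0 : 0 < (α * β / 2) ^ m := by positivity
  have hκ1 : (α * β / 2) ^ m ≤ 1 := pow_le_one₀ (by positivity) (by nlinarith)
  set κ := (α * β / 2) ^ m with hκ
  set e := Real.exp (-(β ^ 2 / 2 * (l + 1 : ℕ))) with he
  have he0 : 0 < e := Real.exp_pos _
  have hcard : (1 : ℝ) ≤ A.card := by exact_mod_cast hA.card_pos
  have hl' : A.card * (4 * (m + 1) * e) ≤ κ := by
    rw [div_mul_eq_mul_div, mul_div_assoc', div_le_one hκ0] at hl
    exact hl
  have hδ : 0 ≤ γ ^ 2 * κ := by positivity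
  have hδ1 : γ ^ 2 * κ ≤ 1 := mul_le_one₀ (pow_le_one₀ hγ hγ1) hκ0.le hκ1
  set f : ℝ → ℝ := fun t => ∑ i ∈ A, μ.real {ω | delayed Δ X H i (N i) (u i) ω (4 * l + 1) ≤ t}
    with hf
  by_cases hdead : ∀ t, f t < 1 / 2
  · have := half_le_all_top (fun i hi => hS.measurable_delayed hi (N i) (4 * l + 1) (u i)) hdead
    calc γ ^ 2 * κ / 32 ≤ 1 / 2 := by linarith
      _ ≤ _ := this
      _ ≤ _ := measureReal_mono (fun ω hω => Or.inr hω) (measure_ne_top _ _)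
  push Not at hdead
  obtain ⟨t₁, ht₁⟩ := hdead
  -- Delays and noise are almost surely non-negative, so nothing happens before the earliest
  -- starting time.
  have hbelow : ∃ t₀ : ℝ, ∀ t < t₀, f t < 1 / 2 := by
    obtain ⟨t₀, ht₀⟩ := (A.image fun i => (u i).toReal).bddBelow
    refine ⟨t₀, fun t ht => ?_⟩
    have : f t = 0 := by
      refine Finset.sum_eq_zero fun i hi => ?_
      rw [measureReal_eq_zero_iff]
      refine measure_mono_null ?_ (ae_iff.1 (hS.ae_nonneg hnonneg))
      intro ω hω h
      have h1 : ((t₀ : ℝ) : EReal) ≤ u i :=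
        le_trans (EReal.coe_le_coe_iff.2 (ht₀ (Finset.mem_coe.2 (Finset.mem_image_of_mem _ hi))))
          (EReal.coe_toReal_le (hu i hi))
      have h2 : delayed Δ X H i (N i) (u i) ω (4 * l + 1) ≤ t := hω
      have h3 := (h1.trans (hS.le_delayed hi (N i) (4 * l + 1) (u i) h)).trans h2
      exact absurd ht (not_lt.2 (by exact_mod_cast h3))
    rw [this]
    norm_num
  obtain ⟨t₀, ht₀⟩ := hbelow
  -- If `p > 1 / 2`, each process survives the block with probability at most `e`, because `1 / 2 ≤
  -- 1 - β ^ 2 / 2 ≤ Real.exp (-(β ^ 2 / 2))`. Then `f t₁ ≤ A.card * e ≤ 1 / 4`, a contradiction.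
  have hp2 : p ≤ 1 / 2 := by
    by_contra! hp2
    have hq0 : 0 ≤ 1 - p := by linarith [hp.2]
    have h1 : ∀ i ∈ A, μ.real {ω | delayed Δ X H i (N i) (u i) ω (4 * l + 1) ≤ t₁} ≤ e := by
      intro i hi
      induction hui : u i using EReal.rec with
      | bot => exact absurd hui (hu i hi)
      | top =>
        simp only [hS.delayed_top i hi]
        have : {ω : Ω | (⊤ : EReal) ≤ (t₁ : EReal)} = ∅ := by ext; simp
        rw [this, measureReal_empty]
        exact he0.le
      | coe x =>
        rw [hS.real_delayed_le hp hi]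
        refine (mul_le_of_le_one_right (by positivity) measureReal_le_one).trans ?_
        calc (1 - p) ^ (4 * l + 1) ≤ (1 - p) ^ (l + 1) :=
              pow_le_pow_of_le_one hq0 (by linarith [hp.1]) (by omega)
          _ ≤ (Real.exp (-(β ^ 2 / 2))) ^ (l + 1) := by
              gcongr
              have := Real.add_one_le_exp (-(β ^ 2 / 2))
              nlinarith
          _ = e := by
              rw [he, ← Real.exp_nat_mul]
              congr 1
              ring
    have h2 := Finset.sum_le_card_nsmul A _ _ h1
    rw [nsmul_eq_mul] at h2
    have h3 : (1 : ℝ) / 2 ≤ A.card * e := ht₁.trans h2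
    have h4 : A.card * e * 4 ≤ A.card * (4 * (m + 1) * e) := by
      have : (0 : ℝ) ≤ m := Nat.cast_nonneg m
      have : 0 ≤ A.card * e * m := by positivity
      nlinarith
    linarith
  obtain ⟨t, ht, htd⟩ := exists_threshold hd ht₀ ht₁
  -- The tail error after factoring out `κ`. The block is long enough for its total over `A` to be
  -- at most half of `f t ≥ 1 / 2`.
  set η := m * e / κ with hη
  have hη0 : 0 ≤ η := by positivity
  have hηn : A.card * η ≤ 1 / 4 := by
    rw [hη, mul_div_assoc', div_le_iff₀ hκ0]
    have : 0 ≤ A.card * e := by positivity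
    nlinarith
  set B : ℕ → Set Ω := fun i =>
    {ω | delayed Δ X H i (N i) (u i) ω (4 * l + 3) ≤ (t - d : ℝ) ∧
      delayed Δ X H i (N i) (u i) ω (4 * l + 1) ≤ (t - d : ℝ)} with hB
  set E : ℕ → Set Ω := fun i => {ω | delayed Δ X H i (N i) (u i) ω (4 * l + 1) ≤ (t - d : ℝ)}
    with hE
  have hBm : ∀ i ∈ A, MeasurableSet[scheduleSigma A X H {q | q.2.1 = i}] (B i) := fun i hi =>
    MeasurableSet.inter
      (measurable_delayed_sigma (S := {q | q.2.1 = i}) hi (fun _ _ _ => rfl) _ measurableSet_Iic)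
      (measurable_delayed_sigma (S := {q | q.2.1 = i}) hi (fun _ _ _ => rfl) _ measurableSet_Iic)
  have hEm : ∀ i ∈ A, MeasurableSet[scheduleSigma A X H {q | q.2.1 = i}] (E i) := fun i hi =>
    measurable_delayed_sigma (S := {q | q.2.1 = i}) hi (fun _ _ _ => rfl) _ measurableSet_Iic
  have hsum := half_sum_le_measure_unique (μ := μ) (A := A) (a := E) (b := B)
    (fun i hi => hS.sigma_le _ _ (hEm i hi)) (fun i hi => hS.sigma_le _ _ (hBm i hi))
    (fun i hi ω hω => hω.2)
    (fun i hi k hk hki => hS.real_inter (Set.disjoint_left.2 fun q h1 h2 => hki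
      ((show q.2.1 = k from h2).symm.trans (show q.2.1 = i from h1))) (hBm i hi) (hEm k hk))
    htd.le
  have hBlow : ∀ i ∈ A, γ ^ 2 * κ / 4 *
      (μ.real {ω | delayed Δ X H i (N i) (u i) ω (4 * l + 1) ≤ t} - η) ≤ μ.real (B i) :=
    fun i hi => hS.real_finish_write hp hp2 hi (hN i hi) hα.le ha hβ hb hx₀ hγ hF hm hη0
      (by rw [hη, mul_div_cancel₀ _ hκ0.ne']) (hu i hi) t
  have hBsum := Finset.sum_le_sum hBlow
  rw [← Finset.mul_sum, Finset.sum_sub_distrib, Finset.sum_const, nsmul_eq_mul] at hBsum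
  have h1 : (1 : ℝ) / 4 ≤ f t - A.card * η := by linarith
  -- Halving this sum, as `hsum` does, gives the constant `1 / 32`.
  have h2 : γ ^ 2 * κ / 4 * (1 / 4) ≤ ∑ i ∈ A, μ.real (B i) :=
    (mul_le_mul_of_nonneg_left h1 (by positivity)).trans hBsum
  refine le_trans (by linarith) (hsum.trans (measureReal_mono ?_ (measure_ne_top _ _)))
  rintro ω ⟨i, hi, hω, hother⟩
  exact Or.inl ⟨i, hi, fun k hk hki => hω.1.trans_lt (not_le.1 (hother k hk hki))⟩

end IsNoisySchedule

end

/-! ### Chaining the blocks -/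

/-- Conditioning on the past without naming a random vector: the identity map, viewed as measurable
into `m₁` and into `m₂`, supplies the two independent variables. The first copy of `ω` carries the
past, the second the future. -/
theorem measure_inter_diag_le {Ω : Type*} {m₁ m₂ : MeasurableSpace Ω} [mΩ : MeasurableSpace Ω]
    {μ : Measure Ω} [IsProbabilityMeasure μ] (h₁ : m₁ ≤ mΩ) (h₂ : m₂ ≤ mΩ) (hind : Indep m₁ m₂ μ)
    {P : Set Ω} (hP : MeasurableSet[m₁] P) {G : Set (Ω × Ω)} (hG : MeasurableSet[m₁.prod m₂] G)
    {q : ℝ≥0∞} (hq : ∀ ω', μ {ω | (ω', ω) ∈ G} ≤ q) :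
    μ {ω | ω ∈ P ∧ (ω, ω) ∈ G} ≤ q * μ P := by
  have hi := (@IndepFun_iff_Indep Ω Ω Ω mΩ m₁ m₂ id id μ).2
    (by rwa [MeasurableSpace.comap_id, MeasurableSpace.comap_id])
  exact @measure_and_le_mul_of_indepFun Ω Ω Ω mΩ μ _ m₁ m₂ id id (measurable_id'' h₁)
    (measurable_id'' h₂) hi P hP G hG q hq

theorem measurableSet_lead {α : Type*} {mα : MeasurableSpace α} {A : Finset ℕ}
    {f g : ℕ → α → EReal} (hf : ∀ i ∈ A, Measurable (f i)) (hg : ∀ i ∈ A, Measurable (g i)) :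
    MeasurableSet {x | (∃ i ∈ A, ∀ k ∈ A, k ≠ i → f i x < g k x) ∨ ∀ i ∈ A, g i x = ⊤} := by
  have h : {x | (∃ i ∈ A, ∀ k ∈ A, k ≠ i → f i x < g k x) ∨ ∀ i ∈ A, g i x = ⊤} =
      (⋃ i ∈ A, ⋂ k ∈ A.erase i, {x | f i x < g k x}) ∪ ⋂ i ∈ A, g i ⁻¹' {⊤} := by
    ext x
    simp [Finset.mem_erase, and_imp]
    grind
  rw [h]
  refine (Finset.measurableSet_biUnion _ fun i hi => Finset.measurableSet_biInter _ fun k hk =>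
    measurableSet_lt (hf i hi) (hg k (Finset.mem_of_mem_erase hk))).union
    (Finset.measurableSet_biInter _ fun i hi => hg i hi (measurableSet_singleton _))

/-- Block `m` consists of the `l + 1` rounds ending with round `r + (m + 1) * (l + 1)`, so that last
round starts `4 * l` operations into the block. -/
theorem opsBefore_add {ps : ProcState} {r : ℕ} (h : ps.round ≤ r) (l m : ℕ) :
    opsBefore ps (r + (m + 1) * (l + 1)) = opsBefore ps (r + 1) + 4 * (l + 1) * m + 4 * l := by
  have := ps.loc.stage_lt
  obtain ⟨x, rfl⟩ := Nat.exists_eq_add_of_le h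
  unfold opsBefore
  have e1 : ps.round + x + (m + 1) * (l + 1) - ps.round = x + (m + 1) * (l + 1) := by omega
  have e2 : ps.round + x + 1 - ps.round = x + 1 := by omega
  have e3 : (m + 1) * (l + 1) = (l + 1) * m + l + 1 := by ring
  rw [e1, e2, e3]
  have e4 : 4 * (l + 1) * m = 4 * ((l + 1) * m) := by ring
  omega

section

variable {Ω : Type*} {c : Config} {A : Finset ℕ}
  {Δ : ℕ → ℕ → ℝ} {X : ℕ → ℕ → Ω → ℝ} {H : ℕ → ℕ → Ω → EReal}

theorem opTime_eq_delayed (ω : Ω) (i k : ℕ) :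
    opTime Δ X H ω i k = delayed Δ X H i 0 (Δ i 0) ω k := by
  rw [← Nat.zero_add k, opTime_add]
  simp [opTime]

theorem measurable_opTime_sigma {S : Set (Bool × ℕ × ℕ)} {i k : ℕ} (hi : i ∈ A)
    (hS : ∀ b, ∀ j ≤ k, (b, i, j) ∈ S) :
    Measurable[scheduleSigma A X H S] fun ω => opTime Δ X H ω i k := by
  simp only [opTime_eq_delayed]
  exact measurable_delayed_sigma hi
    (fun b j hj => hS b j (by have := (Finset.mem_Ioc.1 hj).2; omega)) _

theorem leads_iff_blockLead {r : ℕ} (hr : ∀ i, (c.proc i).round ≤ r) (l m : ℕ) (ω : Ω) :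
    Leads A (opTime Δ X H ω) c (r + (m + 1) * (l + 1)) ↔
      BlockLead A Δ X H (fun i => opsBefore (c.proc i) (r + 1) + 4 * (l + 1) * m) l
        (fun i => opTime Δ X H ω i (opsBefore (c.proc i) (r + 1) + 4 * (l + 1) * m)) ω := by
  unfold Leads BlockLead
  simp only [← opTime_add, opsBefore_add (hr _), add_assoc]

theorem measurableSet_blockLead_prod {S T : Set (Bool × ℕ × ℕ)} {N : ℕ → ℕ} (l : ℕ)
    (hS : ∀ i, ∀ b, ∀ j ≤ N i, (b, i, j) ∈ S) (hT : ∀ i, ∀ b, ∀ j, N i < j → (b, i, j) ∈ T) :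
    MeasurableSet[(scheduleSigma A X H S).prod (scheduleSigma A X H T)]
      {z : Ω × Ω | BlockLead A Δ X H N l (fun i => opTime Δ X H z.1 i (N i)) z.2} := by
  have hd : ∀ i ∈ A, ∀ k, Measurable[(scheduleSigma A X H S).prod (scheduleSigma A X H T)]
      fun z : Ω × Ω => delayed Δ X H i (N i) (opTime Δ X H z.1 i (N i)) z.2 k := by
    intro i hi k
    have h1 : Measurable[scheduleSigma A X H S] fun ω => opTime Δ X H ω i (N i) :=
      measurable_opTime_sigma hi fun b j hj => hS i b j hj
    have h2 : Measurable[scheduleSigma A X H T] fun ω => delayed Δ X H i (N i) 0 ω k :=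
      measurable_delayed_sigma hi (fun b j hj => hT i b j (Finset.mem_Ioc.1 hj).1) 0
    have h3 := (h1.comp (@measurable_fst Ω Ω (scheduleSigma A X H S) (scheduleSigma A X H T))).add
      (h2.comp (@measurable_snd Ω Ω (scheduleSigma A X H S) (scheduleSigma A X H T)))
    -- The time splits into a past summand depending on `z.1` and a future summand depending on
    -- `z.2`, which yields joint measurability.
    have e : (fun z : Ω × Ω => delayed Δ X H i (N i) (opTime Δ X H z.1 i (N i)) z.2 k) =
        fun z => opTime Δ X H z.1 i (N i) + delayed Δ X H i (N i) 0 z.2 k := by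
      ext z
      simp [delayed]
    rw [e]
    exact h3
  exact measurableSet_lead (fun i hi => hd i hi (4 * l + 3)) (fun i hi => hd i hi (4 * l + 1))

end

section

variable {Ω : Type*} [mΩ : MeasurableSpace Ω] {μ : Measure Ω}
  {F : OpType → Measure ℝ} {M p : ℝ} {c : Config} {A : Finset ℕ}
  {Δ : ℕ → ℕ → ℝ} {X : ℕ → ℕ → Ω → ℝ} {H : ℕ → ℕ → Ω → EReal}

namespace IsNoisySchedule

theorem opTime_ne_bot (hS : IsNoisySchedule μ F M p c A Δ X H) {i : ℕ} (hi : i ∈ A) (k : ℕ)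
    (ω : Ω) : opTime Δ X H ω i k ≠ ⊥ := by
  rw [opTime_eq_delayed]
  rcases hS.delayed_cases hi 0 k (Δ i 0) ω with ⟨-, h⟩ | ⟨-, h⟩ <;> rw [h]
  · exact EReal.coe_ne_bot _
  · simp

theorem monotone_opTime (hS : IsNoisySchedule μ F M p c A Δ X H) {ω : Ω}
    (hω : ∀ i ∈ A, ∀ j, 1 ≤ j → 0 ≤ X i j ω) {i : ℕ} (hi : i ∈ A) :
    Monotone (opTime Δ X H ω i) :=
  monotone_nat_of_le_succ fun k => by
    rw [opTime_add]
    exact hS.le_delayed hi k 1 _ hω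

/-- The probability that no lead occurs in any of the first `k` blocks decays exponentially,
if it is bounded for each block and all starting times. -/
theorem measure_no_lead_le [IsProbabilityMeasure μ] (hS : IsNoisySchedule μ F M p c A Δ X H)
    {r : ℕ} (hr : ∀ i, (c.proc i).round ≤ r) {l : ℕ} {ε : ℝ}
    (hblock : ∀ (m : ℕ) (u : ℕ → EReal), (∀ i ∈ A, u i ≠ ⊥) →
      ε ≤ μ.real {ω | BlockLead A Δ X H
        (fun i => opsBefore (c.proc i) (r + 1) + 4 * (l + 1) * m) l u ω}) (k : ℕ) :
    MeasurableSet {ω | ∀ m < k, ¬Leads A (opTime Δ X H ω) c (r + (m + 1) * (l + 1))} ∧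
    μ {ω | ∀ m < k, ¬Leads A (opTime Δ X H ω) c (r + (m + 1) * (l + 1))} ≤
      ENNReal.ofReal (1 - ε) ^ k := by
  set N : ℕ → ℕ → ℕ := fun m i => opsBefore (c.proc i) (r + 1) + 4 * (l + 1) * m with hN
  have hmeas : ∀ k, MeasurableSet[scheduleSigma A X H {q | q.2.2 ≤ N k q.2.1}]
      {ω | ∀ m < k, ¬Leads A (opTime Δ X H ω) c (r + (m + 1) * (l + 1))} := by
    intro k
    have e : {ω | ∀ m < k, ¬Leads A (opTime Δ X H ω) c (r + (m + 1) * (l + 1))} =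
        ⋂ m ∈ Finset.range k, {ω | Leads A (opTime Δ X H ω) c (r + (m + 1) * (l + 1))}ᶜ := by
      ext ω; simp
    rw [e]
    refine Finset.measurableSet_biInter _ fun m hm => MeasurableSet.compl ?_
    -- A lead in block `m` is determined by the operations up to the write in its last round, all of
    -- which precede block `k`.
    have hm : m + 1 ≤ k := Finset.mem_range.1 hm
    have hle : ∀ i, ∀ j ≤ opsBefore (c.proc i) (r + (m + 1) * (l + 1)) + 3, j ≤ N k i := by
      intro i j hj
      rw [opsBefore_add (hr i)] at hj
      have h := Nat.mul_le_mul_left (4 * (l + 1)) hm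
      rw [Nat.mul_add_one] at h
      simp only [hN]
      omega
    exact measurableSet_lead
      (fun i hi => measurable_opTime_sigma hi fun b j hj => hle i j hj)
      (fun i hi => measurable_opTime_sigma hi fun b j hj => hle i j (by omega))
  refine ⟨hS.sigma_le _ _ (hmeas k), ?_⟩
  induction k with
  | zero => simp
  | succ k ih =>
    have hdisj : Disjoint {q : Bool × ℕ × ℕ | q.2.2 ≤ N k q.2.1} {q | N k q.2.1 < q.2.2} :=
      Set.disjoint_left.2 fun q h1 h2 => by
        have h1 : q.2.2 ≤ N k q.2.1 := h1
        have h2 : N k q.2.1 < q.2.2 := h2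
        omega
    have := measure_inter_diag_le (hS.sigma_le _) (hS.sigma_le _) (hS.indep_sigma hdisj) (hmeas k)
      (measurableSet_blockLead_prod (Δ := Δ) l (fun i b j hj => hj) (fun i b j hj => hj)).compl
      (q := ENNReal.ofReal (1 - ε)) ?_
    · rw [pow_succ']
      refine le_trans (measure_mono ?_) (this.trans (mul_le_mul_right ih _))
      intro ω hω
      refine ⟨fun m hm => hω m (by omega), ?_⟩
      have := hω k (by omega)
      rw [leads_iff_blockLead hr] at this
      exact this
    · intro ω'
      have h1 := hblock k (fun i => opTime Δ X H ω' i (N k i)) fun i hi => hS.opTime_ne_bot hi _ _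
      have hm : MeasurableSet {ω | BlockLead A Δ X H (N k) l
          (fun i => opTime Δ X H ω' i (N k i)) ω} :=
        measurableSet_lead (fun i hi => hS.measurable_delayed hi _ _ _)
          (fun i hi => hS.measurable_delayed hi _ _ _)
      have h2 := probReal_compl_eq_one_sub (μ := μ) hm
      rw [← ofReal_measureReal]
      apply ENNReal.ofReal_le_ofReal
      change μ.real ({ω | BlockLead A Δ X H (N k) l (fun i => opTime Δ X H ω' i (N k i)) ω}ᶜ) ≤ _
      linarith

/-- Doubling the block length absorbs the one extra round after a lead, so the bound is a multiple
of the number of blocks. -/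
theorem ae_extraRounds_le (hS : IsNoisySchedule μ F M p c A Δ X H) (hc : c.WellFormed)
    (hA : ∀ i ∈ A, (c.proc i).loc ≠ .decided) (hnonneg : ∀ π, F π (Set.Iio 0) = 0)
    {r : ℕ} (hr : ∀ i, (c.proc i).round ≤ r) (l : ℕ) :
    ∀ᵐ ω ∂μ, ∀ m, Leads A (opTime Δ X H ω) c (r + (m + 1) * (l + 1)) →
      (extraRounds A (opTime Δ X H ω) c r : ℝ≥0∞) ≤ ((m + 1) * (2 * (l + 1)) : ℕ) := by
  filter_upwards [hS.ae_nonneg hnonneg] with ω hω m hm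
  have h := Leads.extraRounds_le hc hr hA (fun i hi => hS.monotone_opTime hω hi)
    (by nlinarith [Nat.zero_le (m * l)]) hm
  have h2 : extraRounds A (opTime Δ X H ω) c r ≤ (((m + 1) * (2 * (l + 1)) : ℕ) : ℕ∞) :=
    h.trans (by exact_mod_cast (by nlinarith [Nat.zero_le (m * l)]))
  exact_mod_cast h2

theorem lintegral_extraRounds_le (hS : IsNoisySchedule μ F M p c A Δ X H) (hc : c.WellFormed)
    (hA : ∀ i ∈ A, (c.proc i).loc ≠ .decided) (hnonneg : ∀ π, F π (Set.Iio 0) = 0)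
    {r : ℕ} (hr : ∀ i, (c.proc i).round ≤ r) {l : ℕ} {ε : ℝ} (hε : 0 < ε) (hε1 : ε ≤ 1)
    (hbad : ∀ k, MeasurableSet {ω | ∀ m < k, ¬Leads A (opTime Δ X H ω) c (r + (m + 1) * (l + 1))} ∧
      μ {ω | ∀ m < k, ¬Leads A (opTime Δ X H ω) c (r + (m + 1) * (l + 1))} ≤
        ENNReal.ofReal (1 - ε) ^ k) :
    ∫⁻ ω, (extraRounds A (opTime Δ X H ω) c r : ℝ≥0∞) ∂μ ≤
      ENNReal.ofReal (2 * (l + 1) / ε) := by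
  set B : ℕ → Set Ω := fun k =>
    {ω | ∀ m < k, ¬Leads A (opTime Δ X H ω) c (r + (m + 1) * (l + 1))} with hB
  set w : ℝ≥0∞ := ((2 * (l + 1) : ℕ) : ℝ≥0∞) with hw
  calc ∫⁻ ω, (extraRounds A (opTime Δ X H ω) c r : ℝ≥0∞) ∂μ
      ≤ ∫⁻ ω, ∑' k, (B k).indicator (fun _ => w) ω ∂μ := by
        refine lintegral_mono_ae ?_
        filter_upwards [hS.ae_extraRounds_le hc hA hnonneg hr l] with ω hω
        -- The sum charges `w` for each block that is entered without an earlier lead: up to the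
        -- first successful block if there is one, and infinitely often otherwise.
        by_cases hex : ∃ m, Leads A (opTime Δ X H ω) c (r + (m + 1) * (l + 1))
        · classical
          have hfirst : ∀ k < Nat.find hex + 1, (B k).indicator (fun _ => w) ω = w := by
            intro k hk
            apply Set.indicator_of_mem
            exact fun m hm => Nat.find_min hex (by omega)
          calc _ ≤ _ := hω _ (Nat.find_spec hex)
            _ = ∑ k ∈ Finset.range (Nat.find hex + 1), (B k).indicator (fun _ => w) ω := by
              rw [Finset.sum_congr rfl fun k hk => hfirst k (Finset.mem_range.1 hk)]
              simp [hw]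
            _ ≤ _ := ENNReal.sum_le_tsum _
        · push Not at hex
          have : ∀ k, (B k).indicator (fun _ => w) ω = w := fun k =>
            Set.indicator_of_mem (show ω ∈ B k from fun m _ => hex m) _
          simp only [this]
          rw [ENNReal.tsum_const_eq_top_of_ne_zero (by simp [hw])]
          exact le_top
    _ = ∑' k, w * μ (B k) := by
        rw [lintegral_tsum fun k => (measurable_const.indicator (hbad k).1).aemeasurable]
        exact tsum_congr fun k => lintegral_indicator_const (hbad k).1 w
    _ ≤ ∑' k, w * ENNReal.ofReal (1 - ε) ^ k :=
        ENNReal.tsum_le_tsum fun k => mul_le_mul_right (hbad k).2 w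
    _ = ENNReal.ofReal (2 * (l + 1) / ε) := by
        rw [ENNReal.tsum_mul_left, ENNReal.tsum_geometric, ENNReal.ofReal_sub _ hε.le,
          ENNReal.ofReal_one, ENNReal.sub_sub_cancel ENNReal.one_ne_top
            (ENNReal.ofReal_le_one.2 hε1), ENNReal.ofReal_div_of_pos hε, div_eq_mul_inv, hw]
        congr 1
        rw [← ENNReal.ofReal_natCast]
        push_cast
        rfl

theorem measure_extraRounds_gt_le (hS : IsNoisySchedule μ F M p c A Δ X H) (hc : c.WellFormed)
    (hA : ∀ i ∈ A, (c.proc i).loc ≠ .decided) (hnonneg : ∀ π, F π (Set.Iio 0) = 0)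
    {r : ℕ} (hr : ∀ i, (c.proc i).round ≤ r) {l : ℕ} {ε : ℝ}
    (hbad : ∀ k, μ {ω | ∀ m < k, ¬Leads A (opTime Δ X H ω) c (r + (m + 1) * (l + 1))} ≤
        ENNReal.ofReal (1 - ε) ^ k) {s : ℕ} {k : ℝ} (hk : s * (2 * (l + 1)) ≤ k) :
    μ {ω | ENNReal.ofReal k < (extraRounds A (opTime Δ X H ω) c r : ℝ≥0∞)} ≤
      ENNReal.ofReal (1 - ε) ^ s := by
  refine le_trans (measure_mono_ae ?_) (hbad s)
  filter_upwards [hS.ae_extraRounds_le hc hA hnonneg hr l] with ω hω hlt m hm hlead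
  have hlt : ENNReal.ofReal k < (extraRounds A (opTime Δ X H ω) c r : ℝ≥0∞) := hlt
  refine absurd (hlt.trans_le (hω m hlead)) (not_lt.2 ?_)
  rw [← ENNReal.ofReal_natCast]
  apply ENNReal.ofReal_le_ofReal
  refine le_trans ?_ hk
  have : ((m : ℝ) + 1) ≤ s := by exact_mod_cast hm
  push_cast
  gcongr

end IsNoisySchedule

end

end NoisyConsensus

/-! ### Choice of the constants -/

theorem mainTheorem1
    (F : NoisyConsensus.OpType → Measure ℝ) (hprob : ∀ π, IsProbabilityMeasure (F π))
    (hnonneg : ∀ π, F π (Set.Iio 0) = 0) (hnonconst : ∀ π, ∀ x : ℝ, F π ≠ Measure.dirac x)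
    (M : ℝ) (h : ℕ → ℝ) (hh : ∀ n, h n ∈ Set.Icc (0 : ℝ) 1) :
    ∃ C : ℝ, 0 < C ∧
      ∀ n : ℕ, 2 ≤ n →
      ∀ (c : NoisyConsensus.Config), NoisyConsensus.Reachable c →
      ∀ r : ℕ, IsGreatest (Set.range fun i => (c.proc i).round) r →
      ∀ A : Finset ℕ, A.card = n → (∀ i ∈ A, (c.proc i).loc ≠ NoisyConsensus.Loc.decided) →
      ∀ (Ω : Type*) [MeasurableSpace Ω] (μ : Measure Ω) [IsProbabilityMeasure μ]
        (Δ : ℕ → ℕ → ℝ) (X : ℕ → ℕ → Ω → ℝ) (H : ℕ → ℕ → Ω → EReal),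
        NoisyConsensus.IsNoisySchedule μ F M (h n) c A Δ X H →
        ∫⁻ ω, (NoisyConsensus.extraRounds A (NoisyConsensus.opTime Δ X H ω) c r : ℝ≥0∞) ∂μ
            ≤ ENNReal.ofReal (C * Real.log n) ∧
        ∀ k : ℝ, 0 ≤ k →
          μ {ω | ENNReal.ofReal k <
              (NoisyConsensus.extraRounds A (NoisyConsensus.opTime Δ X H ω) c r : ℝ≥0∞)}
            ≤ ENNReal.ofReal (Real.exp (-(⌊k / (C * Real.log n)⌋₊ : ℝ))) := by
  obtain ⟨a, b, hab, hα, hβ⟩ :=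
    NoisyConsensus.exists_separated_of_ne_dirac (F .read) (hnonconst .read)
  obtain ⟨x₁, hx₁, hγ₁⟩ := NoisyConsensus.exists_Iic_pos (F .read)
  obtain ⟨x₂, hx₂, hγ₂⟩ := NoisyConsensus.exists_Iic_pos (F .write)
  set α := (F .read).real (Set.Iic a)
  set β := (F .read).real (Set.Ici b)
  set γ := min ((F .read).real (Set.Iic x₁)) ((F .write).real (Set.Iic x₂)) with hγdef
  have hγ : 0 < γ := lt_min hγ₁ hγ₂
  have hF : ∀ π, γ ≤ (F π).real (Set.Iic (max x₁ x₂)) := by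
    rintro (_ | _)
    · exact (min_le_left _ _).trans
        (measureReal_mono (Set.Iic_subset_Iic.2 (le_max_left _ _)) (measure_ne_top _ _))
    · exact (min_le_right _ _).trans
        (measureReal_mono (Set.Iic_subset_Iic.2 (le_max_right _ _)) (measure_ne_top _ _))
  -- Enough swaps for the shift required by `blockLead` with `d = 1`; any positive `d` would do.
  obtain ⟨m, hm⟩ := exists_nat_ge ((1 + 2 * M + 2 * max x₁ x₂) / (b - a))
  rw [div_le_iff₀ (by linarith)] at hm
  have hκ : 0 < (α * β / 2) ^ m := by positivity
  set ε := γ ^ 2 * (α * β / 2) ^ m / 32 with hε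
  have hε0 : 0 < ε := by positivity
  have hε1 : ε ≤ 1 := by
    have h1 : α ≤ 1 := measureReal_le_one
    have h2 : β ≤ 1 := measureReal_le_one
    have h3 : γ ≤ 1 := (hF .read).trans measureReal_le_one
    have h4 : (α * β / 2) ^ m ≤ 1 := pow_le_one₀ (by positivity) (by nlinarith)
    have h5 : γ ^ 2 ≤ 1 := pow_le_one₀ hγ.le h3
    have := mul_le_one₀ h5 hκ.le h4
    linarith
  obtain ⟨C₀, hC₀, hL⟩ := NoisyConsensus.exists_block_length (ν := β ^ 2 / 2)
    (K := 4 * (m + 1) / (α * β / 2) ^ m) (by positivity) (by positivity)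
  -- `Q` blocks without a lead have probability at most `(1 - ε) ^ Q ≤ Real.exp (-1)`.
  obtain ⟨Q, hQ⟩ := exists_nat_ge (1 / ε)
  rw [div_le_iff₀ hε0] at hQ
  -- The summand `1 / ε` serves the expectation, and `Q` serves the tail, where each unit of `k / (C
  -- * Real.log n)` must pay for `Q` blocks.
  refine ⟨2 * C₀ * (1 / ε + Q), by positivity, fun n hn c hc r hr A hAn hA Ω _ μ _ Δ X H hS => ?_⟩
  obtain ⟨L, hL1, hLn, hLe⟩ := hL n hn
  obtain ⟨l, rfl⟩ := Nat.exists_eq_add_of_le' hL1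
  have hround : ∀ i, (c.proc i).round ≤ r := fun i => hr.2 ⟨i, rfl⟩
  have hlog : 0 < Real.log n := Real.log_pos (by exact_mod_cast hn)
  have hAne : A.Nonempty := Finset.card_pos.1 (by omega)
  push_cast at hLn
  have hbad := hS.measure_no_lead_le hround (l := l) (ε := ε) fun m' u hu =>
    hS.blockLead (hh n) hnonneg hAne (fun i hi => by
      have := NoisyConsensus.pos_add_opsBefore (Nat.lt_succ_of_le (hround i))
      unfold NoisyConsensus.ProcState.pos at this
      have e : 4 * (l + 1) * m' = 4 * ((l + 1) * m') := by ring
      simp only [Nat.succ_eq_add_one] at this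
      omega) hα le_rfl hβ le_rfl hprob (hx₁.trans (le_max_left _ _)) hγ.le hF one_pos hm
      (by rw [hAn]; exact hLe) hu
  constructor
  · refine (hS.lintegral_extraRounds_le hc.wellFormed hA hnonneg hround hε0 hε1 hbad).trans
      (ENNReal.ofReal_le_ofReal ?_)
    calc 2 * ((l : ℝ) + 1) / ε ≤ 2 * (C₀ * Real.log n) / ε := by gcongr
      _ = 2 * C₀ * (1 / ε) * Real.log n := by ring
      _ ≤ _ := by
        gcongr
        linarith [(Nat.cast_nonneg Q : (0 : ℝ) ≤ Q)]
  · intro k hk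
    set C := 2 * C₀ * (1 / ε + Q) with hC
    have hCl : 0 < C * Real.log n := by positivity
    set s := ⌊k / (C * Real.log n)⌋₊ with hs
    have hsk : s * (C * Real.log n) ≤ k :=
      (le_div_iff₀ hCl).1 (Nat.floor_le (div_nonneg hk hCl.le))
    have hsQ : ((s * Q : ℕ) : ℝ) * (2 * (l + 1)) ≤ k := by
      refine le_trans ?_ hsk
      have h1 : (Q : ℝ) * (2 * (l + 1)) ≤ C * Real.log n := by
        calc (Q : ℝ) * (2 * (l + 1)) ≤ Q * (2 * (C₀ * Real.log n)) := by gcongr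
          _ = 2 * C₀ * Q * Real.log n := by ring
          _ ≤ _ := by
            rw [hC]
            gcongr
            linarith [one_div_pos.2 hε0]
      push_cast
      rw [mul_assoc]
      gcongr
    refine (hS.measure_extraRounds_gt_le hc.wellFormed hA hnonneg hround (fun k => (hbad k).2)
      hsQ).trans ?_
    rw [← ENNReal.ofReal_pow (by linarith)]
    apply ENNReal.ofReal_le_ofReal
    calc (1 - ε) ^ (s * Q) ≤ Real.exp (-ε) ^ (s * Q) := by
          gcongr
          linarith [Real.add_one_le_exp (-ε)]
      _ = Real.exp (-(s * (Q * ε))) := by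
          rw [← Real.exp_nat_mul]
          congr 1
          push_cast
          ring
      _ ≤ Real.exp (-s) := by
          apply Real.exp_le_exp.2
          nlinarith [(Nat.cast_nonneg s : (0 : ℝ) ≤ s)]
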